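/- Call a pair of finite tuples of positive integers $(a_1,\ldots,a_K)$, $(b_1,\ldots,b_L)$, each taken up to permutation, an integral factorial ratio if $\sum_i a_i=\sum_j b_j$, $a_i\neq b_j$ for all $i,j$, and $$\frac{(a_1n)!\cdots(a_Kn)!}{(b_1n)!\cdots(b_Ln)!}$$ is an integer for every natural number $n$; call it primitive if $\gcd(a_1,\ldots,a_K,b_1,\ldots,b_L)=1$, and put $D=L-K$. **Theorem 5.1.** Each of the following three families is infinite and consists of primitive integral factorial ratios with $D=1$: $$\frac{((a+b)n)!}{(an)!\,(bn)!},\qquad \frac{(2an)!\,(2bn)!}{(an)!\,(bn)!\,((a+b)n)!},\qquad \frac{(2an)!\,(bn)!}{(an)!\,(2bn)!\,((a-b)n)!},$$ where $a$ and $b$ are coprime positive integers, with $a>b$ in the third family, and where the degenerate choices of $(a,b)$, for which some $a_i$ equals some $b_j$, are omitted (these are $(1,1),(1,2),(2,1)$ in the second family and $(2,1)$ in the third). Apart from the members of these three families, there are only finitely many primitive integral factorial ratios with $D=1$ (over all values of $K$). -/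

import Mathlib

open scoped Nat

/-- The factorial ratio `(∏ (aᵢ n)!) / (∏ (bⱼ n)!)`, as a rational number. The tuples
`(a₁, …, a_K)` and `(b₁, …, b_L)` are taken up to permutation, so they are multisets. -/
def factorialRatio (A B : Multiset ℕ) (n : ℕ) : ℚ :=
  (A.map fun a => (((a * n)! : ℕ) : ℚ)).prod / (B.map fun b => (((b * n)! : ℕ) : ℚ)).prod

/-- `(A, B)` is an integral factorial ratio: positive entries, equal sums, no entry common to
`A` and `B`, and the ratio is a natural number for every `n`. -/
structure IsIntegralFactorialRatio (A B : Multiset ℕ) : Prop where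
  pos_left : ∀ a ∈ A, 0 < a
  pos_right : ∀ b ∈ B, 0 < b
  sum_eq : A.sum = B.sum
  nondegenerate : ∀ a ∈ A, a ∉ B
  integral : ∀ n : ℕ, ∃ m : ℕ, factorialRatio A B n = (m : ℚ)

/-- The primitive integral factorial ratios (all entries together have gcd `1`) with exactly `D`
more factorials in the denominator than in the numerator. -/
def primitiveIntegralFactorialRatios (D : ℕ) : Set (Multiset ℕ × Multiset ℕ) :=
  {p | IsIntegralFactorialRatio p.1 p.2 ∧ (p.1 + p.2).gcd = 1 ∧
    Multiset.card p.2 = Multiset.card p.1 + D}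

/-- The family `((a+b)n)! / ((an)! (bn)!)`, with `a`, `b` positive and coprime. -/
def firstFamily : Set (Multiset ℕ × Multiset ℕ) :=
  {p | ∃ a b : ℕ, 0 < a ∧ 0 < b ∧ Nat.Coprime a b ∧ p = ({a + b}, {a, b})}

/-- The family `(2an)! (2bn)! / ((an)! (bn)! ((a+b)n)!)`, with `a`, `b` positive and coprime,
omitting the degenerate pairs `(1, 1)`, `(1, 2)`, `(2, 1)`, for which the numerator and the
denominator have a common factor `(cn)!`. -/
def secondFamily : Set (Multiset ℕ × Multiset ℕ) :=
  {p | ∃ a b : ℕ, 0 < a ∧ 0 < b ∧ Nat.Coprime a b ∧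
    (a, b) ≠ (1, 1) ∧ (a, b) ≠ (1, 2) ∧ (a, b) ≠ (2, 1) ∧
    p = ({2 * a, 2 * b}, {a, b, a + b})}

/-- The family `(2an)! (bn)! / ((an)! (2bn)! ((a-b)n)!)`, with `a > b` positive and coprime,
omitting the degenerate pair `(2, 1)`. -/
def thirdFamily : Set (Multiset ℕ × Multiset ℕ) :=
  {p | ∃ a b : ℕ, 0 < b ∧ b < a ∧ Nat.Coprime a b ∧ (a, b) ≠ (2, 1) ∧
    p = ({2 * a, b}, {a, 2 * b, a - b})}

/-! Encode a pair `(A, B)` by its distinct entries `m i` with nonzero integer weights `c i`,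
positive for the numerator and negative for the denominator. By Landau's criterion, integrality
makes the difference of floor sums nonnegative. When there is one more denominator factor, the
values of this difference at `x` and `-x` add up to `1` off the jumps. Hence it is `0` or `1`, and
`f x = ∑ c i * saw (m i * x)` takes only the values `±1/2`.

Bounded length. The mean of `f ^ 2` is `1/4`, so the quadratic form with kernel `gcd(m, n)² / (m n)`
has value `3` at `c`. At each prime `p` this kernel has a Toeplitz factor `r ^ |j - k|` with `r =
1/p`, bounded below by `(1 - r) / (1 + r)`. Peeling off primes that separate the `m i`, at most as
many as there are entries, bounds the form below by `∏ (p - 1)/(p + 1) * ∑ c i ^ 2`. The product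
over `k` primes is at least a constant times `k ^ (-3/4)`, so only finitely many `c` occur
(`exists_length_bound`).

Fixed weights. Exceptional `m` are counted in sublattices `L` of `ℤ^s` by induction on rank
(`finite_exceptional_of_submodule`). If the function induced on `L ⊗ ℝ` misses `±1/2` on a nonempty
open set, the line in direction `m` must avoid this set modulo the lattice. So `m` is orthogonal to
one of finitely many nonzero characters and lies in a sublattice of smaller rank. Otherwise two
exceptional vectors `m`, `m'` of `L` give a planar function `∑ c i * saw (m i * x + m' i * y)` with
values `±1/2`.

Planar rigidity. Group the linear forms by slope. The form values of the classes add up to `3`. Each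
class is either itself `±1/2`-valued, of form value `3`, or is `± saw (N x)` or `± saw (N x + 1/2)`,
of form value `1`. With at least two slopes there are exactly three classes of the second kind, and
the conditions on the number and sum of entries then leave only the three families. So `m` and `m'`
are proportional, and equal by primitivity. -/

/-! ### The sawtooth function and its distribution relation -/

/-- The sawtooth function, normalised to be odd away from the integers and right-continuous. -/
noncomputable def saw (x : ℝ) : ℝ := 1 / 2 - Int.fract x

theorem saw_add_intCast (x : ℝ) (k : ℤ) : saw (x + k) = saw x := by
  simp [saw]

theorem saw_add_natCast (x : ℝ) (k : ℕ) : saw (x + k) = saw x := by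
  simp [saw]

theorem saw_eq (x : ℝ) : saw x = 1 / 2 - x + ⌊x⌋ := by
  rw [saw, Int.fract]; ring

theorem saw_le (x : ℝ) : saw x ≤ 1 / 2 := by
  have := Int.fract_nonneg x
  rw [saw]; linarith

theorem neg_half_lt_saw (x : ℝ) : -(1 / 2) < saw x := by
  have := Int.fract_lt_one x
  rw [saw]; linarith

theorem abs_saw_le (x : ℝ) : |saw x| ≤ 1 / 2 :=
  abs_le.2 ⟨(neg_half_lt_saw x).le, saw_le x⟩

theorem saw_neg_of_fract_ne_zero {x : ℝ} (h : Int.fract x ≠ 0) : saw (-x) = -saw x := by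
  rw [saw, saw, Int.fract_neg h]; ring

theorem saw_neg_of_fract_eq_zero {x : ℝ} (h : Int.fract x = 0) : saw (-x) = 1 / 2 := by
  rw [saw, Int.fract_neg_eq_zero.2 h]; ring

/-- Since `saw` is `1/2` at the integers, oddness fails exactly at the jumps. This is how jumps are
detected below. -/
theorem saw_add_saw_neg (x : ℝ) : saw x + saw (-x) = if Int.fract x = 0 then 1 else 0 := by
  split_ifs with h
  · rw [saw_neg_of_fract_eq_zero h, saw, h]; norm_num
  · rw [saw_neg_of_fract_ne_zero h]; ring

theorem measurable_saw : Measurable saw := measurable_const.sub measurable_fract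

/-- Hermite's identity: raising `n` by one replaces the term `n / k` by `(n + k) / k = n / k + 1`.
-/
theorem sum_range_add_ediv (k : ℕ) (hk : 0 < k) (n : ℤ) :
    ∑ a ∈ Finset.range k, (n + a) / (k : ℤ) = n := by
  have step : ∀ n : ℤ, ∑ a ∈ Finset.range k, (n + 1 + a) / (k : ℤ)
      = ∑ a ∈ Finset.range k, (n + a) / (k : ℤ) + 1 := by
    intro n
    have h1 := Finset.sum_range_succ (fun a : ℕ => (n + a) / (k : ℤ)) k
    have h2 := Finset.sum_range_succ' (fun a : ℕ => (n + a) / (k : ℤ)) k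
    have h3 : (n + (k : ℕ)) / (k : ℤ) = n / k + 1 := by
      rw [Int.add_ediv_of_dvd_right (dvd_refl _), Int.ediv_self (by positivity)]
    have h4 : ∀ a : ℕ, n + 1 + (a : ℤ) = n + ((a + 1 : ℕ) : ℤ) := by intro a; push_cast; ring
    simp only [h4]
    rw [h1] at h2
    simp only [h3, Nat.cast_zero, add_zero] at h2
    linarith
  have h0 : ∑ a ∈ Finset.range k, ((0 : ℤ) + a) / (k : ℤ) = 0 := by
    apply Finset.sum_eq_zero
    intro a ha
    rw [zero_add]
    exact Int.ediv_eq_zero_of_lt (by positivity) (by exact_mod_cast Finset.mem_range.1 ha)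
  induction n with
  | zero => exact h0
  | succ i ih => rw [step, ih]
  | pred i ih =>
    have := step (-(i : ℤ) - 1)
    rw [sub_add_cancel, ih] at this
    linarith

/-- The distribution relation of the sawtooth function. -/
theorem sum_saw_add_div (k : ℕ) (hk : 0 < k) (y : ℝ) :
    ∑ a ∈ Finset.range k, saw (y + a / k) = saw (k * y) := by
  have hk' : (k : ℝ) ≠ 0 := by positivity
  have hf : ∀ a : ℕ, ⌊y + a / k⌋ = (⌊k * y⌋ + a) / (k : ℤ) := by
    intro a
    have : y + a / k = (k * y + a) / k := by field_simp
    rw [this, Int.floor_div_natCast, Int.floor_add_natCast]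
  have hid := sum_range_add_ediv k hk ⌊k * y⌋
  have hsum : ∑ a ∈ Finset.range k, (a : ℝ) = k * (k - 1) / 2 := by
    have h := Finset.sum_range_id_mul_two k
    have : ((∑ a ∈ Finset.range k, a : ℕ) : ℝ) * 2 = k * (k - 1) := by
      rw [← Nat.cast_pred hk]
      exact_mod_cast h
    push_cast at this
    linarith
  simp only [saw_eq, hf]
  rw [Finset.sum_add_distrib, Finset.sum_sub_distrib, Finset.sum_add_distrib]
  rw [← Int.cast_sum, hid, ← Finset.sum_div _ (fun a : ℕ => (a : ℝ)), hsum]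
  simp only [Finset.sum_const, Finset.card_range, nsmul_eq_mul]
  field_simp
  ring

/-- Multiplication by `n` permutes the residues modulo `k`, and `saw` has period one. -/
theorem sum_saw_add_mul_div {k n : ℕ} (hk : 0 < k) (hn : Nat.Coprime n k) (y : ℝ) :
    ∑ a ∈ Finset.range k, saw (y + n * (a / k)) = saw (k * y) := by
  have hk' : (k : ℝ) ≠ 0 := by positivity
  rw [← sum_saw_add_div k hk y]
  have hinj : Set.InjOn (fun a => n * a % k) (Finset.range k : Set ℕ) := by
    intro a ha b hb hab
    have ha' : a < k := by simpa using ha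
    have hb' : b < k := by simpa using hb
    have h : a ≡ b [MOD k] := Nat.ModEq.cancel_left_of_coprime hn.symm hab
    rwa [Nat.ModEq, Nat.mod_eq_of_lt ha', Nat.mod_eq_of_lt hb'] at h
  have himg : (Finset.range k).image (fun a => n * a % k) = Finset.range k := by
    apply Finset.eq_of_subset_of_card_le
    · intro x hx
      obtain ⟨a, -, rfl⟩ := Finset.mem_image.1 hx
      exact Finset.mem_range.2 (Nat.mod_lt _ hk)
    · rw [Finset.card_image_of_injOn hinj]
  conv_rhs => rw [← himg, Finset.sum_image hinj]
  apply Finset.sum_congr rfl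
  intro a _
  have h : ((n * a : ℕ) : ℝ) = ((n * a % k : ℕ) : ℝ) + k * ((n * a / k : ℕ) : ℝ) := by
    exact_mod_cast (Nat.mod_add_div (n * a) k).symm
  have : y + n * (a / k) = y + ((n * a % k : ℕ) : ℝ) / k + ((n * a / k : ℕ) : ℝ) := by
    push_cast at h
    field_simp
    linarith
  rw [this, saw_add_natCast]

/-! ### Inner products of dilated sawtooth functions -/

theorem intervalIntegrable_of_abs_le {f : ℝ → ℝ} (hf : Measurable f) {C : ℝ}
    (hC : ∀ x, |f x| ≤ C) (a b : ℝ) : IntervalIntegrable f MeasureTheory.volume a b :=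
  (intervalIntegrable_const (c := C)).mono_fun hf.aestronglyMeasurable
    (Filter.Eventually.of_forall fun x => by
      simpa using (hC x).trans (le_abs_self C))

theorem Function.Periodic.intervalIntegral_comp_add {f : ℝ → ℝ} (hf : Function.Periodic f 1)
    (s : ℝ) : ∫ x in (0 : ℝ)..1, f (x + s) = ∫ x in (0 : ℝ)..1, f x := by
  rw [intervalIntegral.integral_comp_add_right, zero_add, add_comm 1 s,
    hf.intervalIntegral_add_eq s 0, zero_add]

theorem Function.Periodic.intervalIntegral_comp_natCast_mul {f : ℝ → ℝ}
    (hf : Function.Periodic f 1) (hi : ∀ a b, IntervalIntegrable f MeasureTheory.volume a b)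
    {n : ℕ} (hn : 0 < n) :
    ∫ x in (0 : ℝ)..1, f (n * x) = ∫ x in (0 : ℝ)..1, f x := by
  have hn' : (n : ℝ) ≠ 0 := by positivity
  rw [intervalIntegral.integral_comp_mul_left _ hn']
  have h := hf.intervalIntegral_add_zsmul_eq n 0 hi
  simp only [natCast_zsmul, nsmul_eq_mul, mul_one, zero_add, mul_zero, smul_eq_mul] at h ⊢
  rw [h]
  field_simp

theorem intervalIntegrable_saw_mul_saw (m n : ℝ) :
    ∀ a b, IntervalIntegrable (fun x => saw (m * x) * saw (n * x)) MeasureTheory.volume a b :=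
  intervalIntegrable_of_abs_le (C := 1 / 2 * (1 / 2))
    ((measurable_saw.comp (measurable_const_mul m)).mul
      (measurable_saw.comp (measurable_const_mul n)))
    fun x => by
      rw [abs_mul]
      exact mul_le_mul (abs_saw_le _) (abs_saw_le _) (abs_nonneg _) (by norm_num)

theorem periodic_saw_mul_saw (m n : ℕ) :
    Function.Periodic (fun x : ℝ => saw (m * x) * saw (n * x)) 1 := by
  intro x
  simp only [mul_add, mul_one, saw_add_natCast]

theorem integral_saw_sq : ∫ x in (0 : ℝ)..1, saw x * saw x = 1 / 12 := by
  have : ∫ x in (0 : ℝ)..1, saw x * saw x = ∫ x in (0 : ℝ)..1, (1 / 4 - x + x ^ 2) := by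
    apply intervalIntegral.integral_congr_ae
    have h1 : ∀ᵐ x : ℝ, x ≠ 1 := by simp [MeasureTheory.ae_iff]
    filter_upwards [h1] with x hx1 hx
    rw [Set.uIoc_of_le zero_le_one] at hx
    rw [saw, Int.fract_eq_self.2 ⟨hx.1.le, lt_of_le_of_ne hx.2 hx1⟩]
    ring
  rw [this]
  have h : IntervalIntegrable (fun x : ℝ => 1 / 4 - x) MeasureTheory.volume 0 1 :=
    (by fun_prop : Continuous fun x : ℝ => 1 / 4 - x).intervalIntegrable _ _
  rw [intervalIntegral.integral_add h ((continuous_pow 2).intervalIntegrable _ _),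
    intervalIntegral.integral_sub (by simp) (by simp)]
  simp [integral_pow]
  norm_num

/-- Averaging over the translates by `a / m` fixes the first factor and, by the distribution
relation, turns the second into `saw (n * (m * x))`. Then `m * x` is substituted by `x`. -/
theorem integral_saw_mul_of_coprime {m n : ℕ} (hm : 0 < m) (h : Nat.Coprime n m) :
    ∫ x in (0 : ℝ)..1, saw (m * x) * saw (n * x)
      = (1 / m) * ∫ x in (0 : ℝ)..1, saw x * saw (n * x) := by
  have hm' : (m : ℝ) ≠ 0 := by positivity
  have key : ∑ a ∈ Finset.range m, ∫ x in (0 : ℝ)..1, saw (m * x) * saw (n * x)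
      = ∫ x in (0 : ℝ)..1, saw (m * x) * saw (n * (m * x)) := by
    have h1 : ∀ a ∈ Finset.range m, ∫ x in (0 : ℝ)..1, saw (m * x) * saw (n * x)
        = ∫ x in (0 : ℝ)..1, saw (m * x) * saw (n * x + n * (a / m)) := by
      intro a _
      rw [← (periodic_saw_mul_saw m n).intervalIntegral_comp_add (a / m)]
      congr 1; ext x
      rw [mul_add (m : ℝ), mul_div_cancel₀ _ hm', saw_add_natCast, mul_add]
    rw [Finset.sum_congr rfl h1, ← intervalIntegral.integral_finsetSum]
    · congr 1; ext x
      rw [← Finset.mul_sum, sum_saw_add_mul_div hm h]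
      congr 2; ring
    · intro a _
      apply intervalIntegrable_of_abs_le (C := 1 / 2 * (1 / 2))
      · exact (measurable_saw.comp (measurable_const_mul _)).mul
          (measurable_saw.comp ((measurable_const_mul _).add_const _))
      · intro x
        rw [abs_mul]
        exact mul_le_mul (abs_saw_le _) (abs_saw_le _) (abs_nonneg _) (by norm_num)
  rw [Finset.sum_const, Finset.card_range, nsmul_eq_mul] at key
  have hp : Function.Periodic (fun x : ℝ => saw x * saw (n * x)) 1 := by
    simpa using periodic_saw_mul_saw 1 n
  have hi := intervalIntegrable_saw_mul_saw 1 n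
  simp only [one_mul] at hi
  rw [hp.intervalIntegral_comp_natCast_mul hi hm] at key
  rw [← key, one_div, inv_mul_cancel_left₀ hm']

/-- The normalised Gram matrix of the functions `x ↦ saw (m x)`. -/
noncomputable def gcdKernel (m n : ℕ) : ℝ := (Nat.gcd m n : ℝ) ^ 2 / (m * n)

/-- Substituting away the gcd reduces to coprime dilations `m'`, `n'`. Using the coprime case once
for each dilation leaves `1 / (m' n')` times the square mean `1/12`. -/
theorem integral_saw_mul_saw {m n : ℕ} (hm : 0 < m) (hn : 0 < n) :
    ∫ x in (0 : ℝ)..1, saw (m * x) * saw (n * x) = gcdKernel m n / 12 := by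
  have hg : 0 < Nat.gcd m n := Nat.gcd_pos_of_pos_left _ hm
  obtain ⟨m', n', hc, hm', hn'⟩ := Nat.exists_coprime m n
  set g := Nat.gcd m n with hgdef
  have hm0 : 0 < m' := Nat.pos_of_ne_zero (by rintro rfl; simp at hm'; omega)
  have hn0 : 0 < n' := Nat.pos_of_ne_zero (by rintro rfl; simp at hn'; omega)
  have h1 : ∫ x in (0 : ℝ)..1, saw (m * x) * saw (n * x)
      = ∫ x in (0 : ℝ)..1, saw (m' * x) * saw (n' * x) := by
    rw [← (periodic_saw_mul_saw m' n').intervalIntegral_comp_natCast_mul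
      (intervalIntegrable_saw_mul_saw _ _) hg]
    congr 1; ext x
    rw [hm', hn']; push_cast
    rw [mul_assoc, mul_assoc]
  have h2 : ∫ x in (0 : ℝ)..1, saw x * saw (n' * x) = (1 / n') * (1 / 12) := by
    have := integral_saw_mul_of_coprime hn0 (Nat.coprime_one_left n')
    simp only [Nat.cast_one, one_mul, integral_saw_sq] at this
    rw [← this]
    simp only [mul_comm]
  rw [h1, integral_saw_mul_of_coprime hm0 hc.symm, h2, gcdKernel, ← hgdef, hm', hn']
  push_cast
  field_simp

/-- The weighted sum of dilated sawtooth functions over the indices in `I`. -/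
noncomputable def sawSum {ι : Type*} (I : Finset ι) (c : ι → ℤ) (m : ι → ℕ) (x : ℝ) : ℝ :=
  ∑ i ∈ I, (c i : ℝ) * saw (m i * x)

/-- The quadratic form of `gcdKernel`, which is twelve times the square mean of `sawSum`. -/
noncomputable def gcdForm {ι : Type*} (I : Finset ι) (c : ι → ℤ) (m : ι → ℕ) : ℝ :=
  ∑ i ∈ I, ∑ j ∈ I, (c i : ℝ) * c j * gcdKernel (m i) (m j)

theorem gcdForm_eq_integral {ι : Type*} (I : Finset ι) (c : ι → ℤ) (m : ι → ℕ)
    (hm : ∀ i ∈ I, 0 < m i) :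
    gcdForm I c m = 12 * ∫ x in (0 : ℝ)..1, sawSum I c m x ^ 2 := by
  have h : ∀ x, sawSum I c m x ^ 2
      = ∑ i ∈ I, ∑ j ∈ I, (c i : ℝ) * c j * (saw (m i * x) * saw (m j * x)) := by
    intro x
    rw [sawSum, sq, Finset.sum_mul_sum]
    refine Finset.sum_congr rfl fun i _ => Finset.sum_congr rfl fun j _ => by ring
  have hint : ∀ i j, IntervalIntegrable
      (fun x => (c i : ℝ) * c j * (saw (m i * x) * saw (m j * x))) MeasureTheory.volume 0 1 :=
    fun i j => (intervalIntegrable_saw_mul_saw _ _ 0 1).const_mul _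
  simp only [h]
  rw [intervalIntegral.integral_finsetSum fun i _ => by
    simpa only [Finset.sum_fn] using IntervalIntegrable.sum I fun j _ => hint i j]
  rw [gcdForm, Finset.mul_sum]
  refine Finset.sum_congr rfl fun i hi => ?_
  rw [intervalIntegral.integral_finsetSum fun j _ => hint i j, Finset.mul_sum]
  refine Finset.sum_congr rfl fun j hj => ?_
  rw [intervalIntegral.integral_const_mul, integral_saw_mul_saw (hm i hi) (hm j hj)]
  ring

theorem gcdForm_eq_three {ι : Type*} {I : Finset ι} {c : ι → ℤ} {m : ι → ℕ}
    (hm : ∀ i ∈ I, 0 < m i) (h : ∀ x, sawSum I c m x = 1 / 2 ∨ sawSum I c m x = -(1 / 2)) :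
    gcdForm I c m = 3 := by
  rw [gcdForm_eq_integral I c m hm]
  have : ∀ x, sawSum I c m x ^ 2 = 1 / 4 := by
    intro x
    rcases h x with h | h <;> rw [h] <;> norm_num
  simp only [this]
  norm_num

/-! ### Lower bound for the gcd form -/

/-- With truncated subtraction the exponent is `|j - k|`. The extra square on the left carries the
induction: appending `u J` increases the right side by more than the left by an explicit multiple of
a perfect square. -/
theorem toeplitz_lower_bound {r : ℝ} (h0 : 0 ≤ r) (h1 : r ≤ 1) (u : ℕ → ℝ) (J : ℕ) :
    (1 - r) / (1 + r) * ∑ j ∈ Finset.range J, u j ^ 2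
      + r * (∑ k ∈ Finset.range J, r ^ (J - 1 - k) * u k) ^ 2
    ≤ ∑ j ∈ Finset.range J, ∑ k ∈ Finset.range J, r ^ ((j - k) + (k - j)) * (u j * u k) := by
  induction J with
  | zero => simp
  | succ J ih =>
    set w := ∑ k ∈ Finset.range J, r ^ (J - 1 - k) * u k with hw
    have hw1 : ∑ k ∈ Finset.range J, r ^ (J - k) * u k = r * w := by
      rw [hw, Finset.mul_sum]
      refine Finset.sum_congr rfl fun k hk => ?_
      have hk := Finset.mem_range.1 hk
      rw [show J - k = (J - 1 - k) + 1 by omega, pow_succ]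
      ring
    have hw2 : ∑ k ∈ Finset.range (J + 1), r ^ (J + 1 - 1 - k) * u k = r * w + u J := by
      rw [Finset.sum_range_succ, Nat.add_sub_cancel, hw1]
      simp
    have hc1 : ∑ k ∈ Finset.range J, r ^ ((J - k) + (k - J)) * (u J * u k) = u J * (r * w) := by
      rw [← hw1, Finset.mul_sum]
      refine Finset.sum_congr rfl fun k hk => ?_
      have hk := Finset.mem_range.1 hk
      rw [show (J - k) + (k - J) = J - k by omega]
      ring
    have hc2 : ∑ k ∈ Finset.range J, r ^ ((k - J) + (J - k)) * (u k * u J) = u J * (r * w) := by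
      rw [← hc1]
      refine Finset.sum_congr rfl fun k _ => ?_
      rw [add_comm, mul_comm (u k)]
    have hS : ∑ j ∈ Finset.range (J + 1), ∑ k ∈ Finset.range (J + 1),
        r ^ ((j - k) + (k - j)) * (u j * u k)
        = (∑ j ∈ Finset.range J, ∑ k ∈ Finset.range J, r ^ ((j - k) + (k - j)) * (u j * u k))
          + 2 * (u J * (r * w)) + u J ^ 2 := by
      simp only [Finset.sum_range_succ, Finset.sum_add_distrib, hc1, hc2]
      simp
      ring
    rw [hS, hw2, Finset.sum_range_succ]
    have hr : 0 < 1 + r := by linarith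
    have key : 2 * (u J * (r * w)) + u J ^ 2 + r * w ^ 2
        - ((1 - r) / (1 + r) * u J ^ 2 + r * (r * w + u J) ^ 2)
        = r * (1 - r) / (1 + r) * (u J + (1 + r) * w) ^ 2 := by
      field_simp
      ring
    have : 0 ≤ r * (1 - r) / (1 + r) * (u J + (1 + r) * w) ^ 2 := by
      have : 0 ≤ 1 - r := by linarith
      positivity
    linarith

/-- The kernel is multiplicative over primes. The factor at `p` depends only on the distance between
the two `p`-adic valuations. -/
theorem gcdKernel_eq_of_prime {p m n : ℕ} (hp : p.Prime) (hm : m ≠ 0) (hn : n ≠ 0) :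
    gcdKernel m n = ((p : ℝ)⁻¹) ^ ((m.factorization p - n.factorization p)
        + (n.factorization p - m.factorization p))
      * gcdKernel (m / p ^ m.factorization p) (n / p ^ n.factorization p) := by
  have hm1 := Nat.ordProj_mul_ordCompl_eq_self m p
  have hn1 := Nat.ordProj_mul_ordCompl_eq_self n p
  have hcm := Nat.coprime_ordCompl hp hm
  have hcn := Nat.coprime_ordCompl hp hn
  have hm0 := Nat.ordCompl_pos p hm
  have hn0 := Nat.ordCompl_pos p hn
  set a := m.factorization p
  set b := n.factorization p
  set m' := m / p ^ a
  set n' := n / p ^ b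
  have hg : Nat.gcd m n = p ^ (min a b) * Nat.gcd m' n' := by
    rw [← hm1, ← hn1]
    rcases le_total a b with h | h
    · obtain ⟨d, hd⟩ := Nat.exists_eq_add_of_le h
      rw [min_eq_left h, hd, pow_add, mul_assoc, Nat.gcd_mul_left]
      congr 1
      exact Nat.Coprime.gcd_mul_left_cancel_right _ (Nat.Coprime.pow_left d hcm)
    · obtain ⟨d, hd⟩ := Nat.exists_eq_add_of_le h
      rw [min_eq_right h, hd, pow_add, mul_assoc, Nat.gcd_mul_left]
      congr 1
      exact Nat.Coprime.gcd_mul_left_cancel _ (Nat.Coprime.pow_left d hcn)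
  have hp0 : (p : ℝ) ≠ 0 := by exact_mod_cast hp.ne_zero
  have hm' : (m : ℝ) = (p : ℝ) ^ a * m' := by exact_mod_cast hm1.symm
  have hn' : (n : ℝ) = (p : ℝ) ^ b * n' := by exact_mod_cast hn1.symm
  have hm0' : (m' : ℝ) ≠ 0 := by positivity
  have hn0' : (n' : ℝ) ≠ 0 := by positivity
  rw [gcdKernel, gcdKernel, hg, hm', hn']
  push_cast
  rcases le_total a b with h | h
  · obtain ⟨d, hd⟩ := Nat.exists_eq_add_of_le h
    rw [min_eq_left h, hd, show a - (a + d) + (a + d - a) = d by omega, inv_pow]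
    field_simp
    ring
  · obtain ⟨d, hd⟩ := Nat.exists_eq_add_of_le h
    rw [min_eq_right h, hd, show (b + d) - b + (b - (b + d)) = d by omega, inv_pow]
    field_simp
    ring

section LengthBound

variable {ι : Type*}

/-- For each `x`, the Toeplitz bound with `r = 1/p` is applied to the partial sums over the classes
of equal `p`-adic valuation, with the powers of `p` removed from the dilations. Integration over `x`
gives the claim. -/
theorem gcdForm_prime_split [DecidableEq ι] {p : ℕ} (hp : p.Prime) (I : Finset ι) (c : ι → ℤ)
    (m : ι → ℕ) (hm : ∀ i ∈ I, 0 < m i) :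
    ∃ J : ℕ, (∀ i ∈ I, (m i).factorization p < J) ∧
      ((p : ℝ) - 1) / (p + 1) *
        ∑ j ∈ Finset.range J, gcdForm (I.filter fun i => (m i).factorization p = j) c m
      ≤ gcdForm I c m := by
  set v : ι → ℕ := fun i => (m i).factorization p with hv
  set m' : ι → ℕ := fun i => m i / p ^ v i with hm'
  have hm0 : ∀ i ∈ I, 0 < m' i := fun i hi => Nat.ordCompl_pos p (hm i hi).ne'
  set r : ℝ := (p : ℝ)⁻¹ with hr
  have hp1 : (1 : ℝ) < p := by exact_mod_cast hp.one_lt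
  have hr0 : 0 ≤ r := by positivity
  have hr1 : r ≤ 1 := inv_le_one_of_one_le₀ hp1.le
  have hlam : ((p : ℝ) - 1) / (p + 1) = (1 - r) / (1 + r) := by
    rw [hr]; field_simp
  obtain ⟨J, hJ⟩ : ∃ J, ∀ i ∈ I, v i < J := by
    refine ⟨I.sup v + 1, fun i hi => Nat.lt_succ_of_le (Finset.le_sup hi)⟩
  refine ⟨J, hJ, ?_⟩
  -- Within one class the valuations agree, so removing the common power of `p` does not change the
  -- kernel.
  have hsame : ∀ j, gcdForm (I.filter fun i => v i = j) c m
      = gcdForm (I.filter fun i => v i = j) c m' := by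
    intro j
    refine Finset.sum_congr rfl fun i hi => Finset.sum_congr rfl fun k hk => ?_
    rw [Finset.mem_filter] at hi hk
    have h := gcdKernel_eq_of_prime hp (hm i hi.1).ne' (hm k hk.1).ne'
    change gcdKernel (m i) (m k) = r ^ ((v i - v k) + (v k - v i)) * gcdKernel (m' i) (m' k) at h
    rw [h, hi.2, hk.2]
    simp
  have hpt : ∀ x : ℝ, (1 - r) / (1 + r) * ∑ j ∈ Finset.range J,
        sawSum (I.filter fun i => v i = j) c m' x ^ 2
      ≤ ∑ i ∈ I, ∑ k ∈ I, (c i : ℝ) * c k * r ^ ((v i - v k) + (v k - v i))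
          * (saw (m' i * x) * saw (m' k * x)) := by
    intro x
    set u : ℕ → ℝ := fun j => sawSum (I.filter fun i => v i = j) c m' x with hu
    have h1 := toeplitz_lower_bound hr0 hr1 u J
    have h2 : ∑ j ∈ Finset.range J, ∑ k ∈ Finset.range J, r ^ ((j - k) + (k - j)) * (u j * u k)
        = ∑ i ∈ I, ∑ k ∈ I, (c i : ℝ) * c k * r ^ ((v i - v k) + (v k - v i))
          * (saw (m' i * x) * saw (m' k * x)) := by
      have hmaps : ∀ i ∈ I, v i ∈ Finset.range J := fun i hi => Finset.mem_range.2 (hJ i hi)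
      rw [← Finset.sum_fiberwise_of_maps_to hmaps]
      refine Finset.sum_congr rfl fun j _ => ?_
      rw [Finset.sum_congr rfl (g := fun i => ∑ k ∈ Finset.range J,
        ∑ l ∈ I with v l = k, (c i : ℝ) * c l * r ^ ((v i - v l) + (v l - v i))
          * (saw (m' i * x) * saw (m' l * x)))
        fun i _ => (Finset.sum_fiberwise_of_maps_to hmaps _).symm]
      rw [Finset.sum_comm]
      refine Finset.sum_congr rfl fun k _ => ?_
      simp only [hu, sawSum]
      rw [Finset.sum_mul_sum, Finset.mul_sum]
      refine Finset.sum_congr rfl fun i hi => ?_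
      rw [Finset.mul_sum]
      refine Finset.sum_congr rfl fun l hl => ?_
      rw [(Finset.mem_filter.1 hi).2, (Finset.mem_filter.1 hl).2]
      ring
    rw [← h2]
    refine le_trans ?_ h1
    have : 0 ≤ r * (∑ k ∈ Finset.range J, r ^ (J - 1 - k) * u k) ^ 2 := by positivity
    linarith
  have hii : ∀ i k, IntervalIntegrable (fun x => (c i : ℝ) * c k *
      r ^ ((v i - v k) + (v k - v i)) * (saw (m' i * x) * saw (m' k * x)))
      MeasureTheory.volume 0 1 :=
    fun i k => (intervalIntegrable_saw_mul_saw _ _ 0 1).const_mul _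
  have hiS : ∀ i, IntervalIntegrable (fun x => ∑ k ∈ I, (c i : ℝ) * c k *
      r ^ ((v i - v k) + (v k - v i)) * (saw (m' i * x) * saw (m' k * x)))
      MeasureTheory.volume 0 1 := fun i => by
    simpa only [Finset.sum_fn] using IntervalIntegrable.sum I fun k _ => hii i k
  have hiu : ∀ j, IntervalIntegrable
      (fun x => sawSum (I.filter fun i => v i = j) c m' x ^ 2) MeasureTheory.volume 0 1 := by
    intro j
    have : ∀ x, sawSum (I.filter fun i => v i = j) c m' x ^ 2
        = ∑ i ∈ I.filter (fun i => v i = j), ∑ k ∈ I.filter (fun i => v i = j),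
          (c i : ℝ) * c k * (saw (m' i * x) * saw (m' k * x)) := by
      intro x
      rw [sawSum, sq, Finset.sum_mul_sum]
      refine Finset.sum_congr rfl fun i _ => Finset.sum_congr rfl fun k _ => by ring
    simp only [this]
    have h2 : ∀ i, IntervalIntegrable (fun x => ∑ k ∈ I.filter (fun i => v i = j),
        (c i : ℝ) * c k * (saw (m' i * x) * saw (m' k * x))) MeasureTheory.volume 0 1 := fun i => by
      simpa only [Finset.sum_fn] using IntervalIntegrable.sum (I.filter fun i => v i = j)
        fun k _ => (intervalIntegrable_saw_mul_saw (m' i) (m' k) 0 1).const_mul ((c i : ℝ) * c k)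
    simpa only [Finset.sum_fn] using IntervalIntegrable.sum (I.filter fun i => v i = j)
        fun k _ => h2 k
  have hL : gcdForm I c m = 12 * ∫ x in (0 : ℝ)..1, ∑ i ∈ I, ∑ k ∈ I, (c i : ℝ) * c k *
      r ^ ((v i - v k) + (v k - v i)) * (saw (m' i * x) * saw (m' k * x)) := by
    rw [intervalIntegral.integral_finsetSum fun i _ => hiS i, gcdForm, Finset.mul_sum]
    refine Finset.sum_congr rfl fun i hi => ?_
    rw [intervalIntegral.integral_finsetSum fun k _ => hii i k, Finset.mul_sum]
    refine Finset.sum_congr rfl fun k hk => ?_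
    rw [intervalIntegral.integral_const_mul, integral_saw_mul_saw (hm0 i hi) (hm0 k hk),
      gcdKernel_eq_of_prime hp (hm i hi).ne' (hm k hk).ne']
    ring
  have hR : ∑ j ∈ Finset.range J, gcdForm (I.filter fun i => v i = j) c m
      = 12 * ∫ x in (0 : ℝ)..1, ∑ j ∈ Finset.range J,
        sawSum (I.filter fun i => v i = j) c m' x ^ 2 := by
    rw [intervalIntegral.integral_finsetSum fun j _ => hiu j, Finset.mul_sum]
    refine Finset.sum_congr rfl fun j _ => ?_
    rw [hsame, gcdForm_eq_integral _ c m' fun i hi => hm0 i (Finset.mem_filter.1 hi).1]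
  rw [hR, hL, hlam, mul_left_comm, ← intervalIntegral.integral_const_mul]
  refine mul_le_mul_of_nonneg_left ?_ (by norm_num)
  refine intervalIntegral.integral_mono_on zero_le_one ?_ ?_ fun x _ => hpt x
  · refine IntervalIntegrable.const_mul ?_ _
    simpa only [Finset.sum_fn] using IntervalIntegrable.sum (Finset.range J) fun j _ => hiu j
  · simpa only [Finset.sum_fn] using IntervalIntegrable.sum I fun i _ => hiS i

/-- Splitting successively at all primes of `P` leaves classes with at most one index, on which the
form is `c i ^ 2`. -/
theorem gcdForm_lower_bound [DecidableEq ι] (c : ι → ℤ) (m : ι → ℕ) (P : Finset ℕ)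
    (hP : ∀ p ∈ P, p.Prime) : ∀ I : Finset ι, (∀ i ∈ I, 0 < m i) →
    (∀ i ∈ I, ∀ j ∈ I, (∀ p ∈ P, (m i).factorization p = (m j).factorization p) → i = j) →
    (∏ p ∈ P, ((p : ℝ) - 1) / (p + 1)) * ∑ i ∈ I, (c i : ℝ) ^ 2 ≤ gcdForm I c m := by
  induction P using Finset.induction_on with
  | empty =>
    intro I hm hI
    rcases I.eq_empty_or_nonempty with rfl | ⟨i, hi⟩
    · simp [gcdForm]
    · have : I = {i} := Finset.eq_singleton_iff_unique_mem.2
        ⟨hi, fun j hj => hI j hj i hi (by simp)⟩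
      subst this
      have : (m i : ℝ) ≠ 0 := by exact_mod_cast (hm i hi).ne'
      simp only [gcdForm, gcdKernel, Finset.sum_singleton, Finset.prod_empty, Nat.gcd_self]
      apply le_of_eq
      field_simp
  | insert p P hpP ih =>
    intro I hm hI
    have hp := hP p (Finset.mem_insert_self _ _)
    obtain ⟨J, hJ, hsplit⟩ := gcdForm_prime_split hp I c m hm
    refine le_trans ?_ hsplit
    rw [Finset.prod_insert hpP, mul_assoc]
    have hp1 : (1 : ℝ) < p := by exact_mod_cast hp.one_lt
    refine mul_le_mul_of_nonneg_left ?_ (div_nonneg (by linarith) (by linarith))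
    rw [← Finset.sum_fiberwise_of_maps_to
      (fun i hi => Finset.mem_range.2 (hJ i hi) : ∀ i ∈ I, _ ∈ Finset.range J), Finset.mul_sum]
    refine Finset.sum_le_sum fun j _ => ?_
    refine ih (fun q hq => hP q (Finset.mem_insert_of_mem hq)) _ ?_ ?_
    · intro i hi
      exact hm i (Finset.mem_filter.1 hi).1
    · intro i hi k hk h
      rw [Finset.mem_filter] at hi hk
      refine hI i hi.1 k hk.1 fun q hq => ?_
      rcases Finset.mem_insert.1 hq with rfl | hq
      · rw [hi.2, hk.2]
      · exact h q hq

/-- One prime per new index suffices: since `P` already separates the old indices, at most one of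
them agrees with the new one at all of `P`. -/
theorem exists_separating_primes [DecidableEq ι] (m : ι → ℕ) (hinj : Function.Injective m)
    (I : Finset ι) (hm : ∀ i ∈ I, 0 < m i) :
    ∃ P : Finset ℕ, (∀ p ∈ P, p.Prime) ∧ P.card ≤ I.card ∧
      ∀ i ∈ I, ∀ j ∈ I, (∀ p ∈ P, (m i).factorization p = (m j).factorization p) → i = j := by
  induction I using Finset.induction_on with
  | empty => exact ⟨∅, by simp⟩
  | insert a I haI ih =>
    obtain ⟨P, hP, hcard, hsep⟩ := ih fun i hi => hm i (Finset.mem_insert_of_mem hi)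
    by_cases hex : ∃ b ∈ I, ∀ p ∈ P, (m a).factorization p = (m b).factorization p
    · obtain ⟨b, hb, hab⟩ := hex
      have hne : m a ≠ m b := fun h => haI (hinj h ▸ hb)
      obtain ⟨q, hq⟩ : ∃ q, (m a).factorization q ≠ (m b).factorization q := by
        by_contra! h
        exact hne (Nat.eq_of_factorization_eq (hm a (Finset.mem_insert_self _ _)).ne'
          (hm b (Finset.mem_insert_of_mem hb)).ne' h)
      have hqp : q.Prime := by
        by_contra h
        exact hq (by rw [Nat.factorization_eq_zero_of_not_prime _ h,
          Nat.factorization_eq_zero_of_not_prime _ h])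
      have hsep_a : ∀ j ∈ I, (∀ p ∈ insert q P,
          (m a).factorization p = (m j).factorization p) → False := by
        intro j hj h
        have : b = j := hsep b hb j hj fun p hp => by
          rw [← hab p hp, h p (Finset.mem_insert_of_mem hp)]
        subst this
        exact hq (h q (Finset.mem_insert_self _ _))
      refine ⟨insert q P, ?_, ?_, ?_⟩
      · intro p hp
        rcases Finset.mem_insert.1 hp with rfl | hp
        exacts [hqp, hP p hp]
      · rw [Finset.card_insert_of_notMem haI]
        exact (Finset.card_insert_le _ _).trans (by omega)
      · intro i hi j hj h
        rcases Finset.mem_insert.1 hi with hi' | hi' <;>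
          rcases Finset.mem_insert.1 hj with hj' | hj'
        · rw [hi', hj']
        · subst hi'
          exact (hsep_a j hj' h).elim
        · subst hj'
          exact (hsep_a i hi' fun p hp => (h p hp).symm).elim
        · exact hsep i hi' j hj' fun p hp => h p (Finset.mem_insert_of_mem hp)
    · push Not at hex
      refine ⟨P, hP, hcard.trans (Finset.card_le_card (Finset.subset_insert _ _)), ?_⟩
      intro i hi j hj h
      rcases Finset.mem_insert.1 hi with rfl | hi' <;>
        rcases Finset.mem_insert.1 hj with hj' | hj'
      · exact hj'.symm
      · obtain ⟨p, hp, hne⟩ := hex j hj'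
        exact (hne (h p hp)).elim
      · subst hj'
        obtain ⟨p, hp, hne⟩ := hex i hi'
        exact (hne (h p hp).symm).elim
      · exact hsep i hi' j hj' h

/-! ### Products over primes and the bound on length and weights -/

/-- Beyond small cases, primes lie in the two residue classes coprime to `6`, so their density is at
most `1/3`. -/
theorem three_mul_card_le_of_primes {P : Finset ℕ} (hP : ∀ p ∈ P, p.Prime) {q : ℕ}
    (hq : ∀ p ∈ P, p ≤ q) : 3 * P.card ≤ q + 10 := by
  have h1 : P.card ≤ Nat.primeCounting' (q + 1) := by
    rw [Nat.primeCounting', Nat.count_eq_card_filter_range]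
    refine Finset.card_le_card fun p hp => ?_
    simp only [Finset.mem_filter, Finset.mem_range]
    exact ⟨Nat.lt_succ_of_le (hq p hp), hP p hp⟩
  have h7 : Nat.primeCounting' 7 = 3 := by decide
  have h6 : Nat.totient 6 = 2 := by decide
  have h2 := Nat.primeCounting'_add_le (a := 6) (k := 7) (by norm_num) (by norm_num) (q + 1 - 7)
  have h3 := Nat.monotone_primeCounting' (show q + 1 ≤ 7 + (q + 1 - 7) by omega)
  rw [h7, h6] at h2
  by_cases h : q < 6
  · have : q + 1 - 7 = 0 := by omega
    have h4 := Nat.monotone_primeCounting' (show q + 1 ≤ 6 by omega)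
    have h5 : Nat.primeCounting' 6 = 3 := by decide
    have h8 := Nat.monotone_primeCounting' (show q + 1 ≤ 7 by omega)
    omega
  · omega

/-- The product is at least `3 ^ (-40) * k ^ (-3/4)`, raised here to the fourth power; any exponent
below `1` would serve. Up to `40` primes, each factor is at least `1/3`. Beyond that, the largest of
`k` primes is at least `3 * k - 10`, so it costs little. -/
theorem prod_primes_lower_bound (P : Finset ℕ) (hP : ∀ p ∈ P, p.Prime) :
    (1 / 3 : ℝ) ^ 160 ≤ (∏ p ∈ P, ((p : ℝ) - 1) / (p + 1)) ^ 4 * max 1 (P.card : ℝ) ^ 3 := by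
  induction P using Finset.induction_on_max with
  | empty => norm_num
  | insert q P hq ih =>
    have hqP : q ∉ P := fun h => lt_irrefl _ (hq q h)
    have hfac : ∀ p : ℕ, p.Prime → (1 / 3 : ℝ) ≤ ((p : ℝ) - 1) / (p + 1) := by
      intro p hp
      have : (2 : ℝ) ≤ p := by exact_mod_cast hp.two_le
      rw [div_le_div_iff₀ (by norm_num) (by linarith)]
      linarith
    have hcard := three_mul_card_le_of_primes hP (q := q) fun p hp => by
      rcases Finset.mem_insert.1 hp with rfl | hp
      exacts [le_rfl, (hq p hp).le]
    by_cases hk : (insert q P).card ≤ 40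
    · have h1 : (1 / 3 : ℝ) ^ 40 ≤ ∏ p ∈ insert q P, ((p : ℝ) - 1) / (p + 1) := by
        refine le_trans (pow_le_pow_of_le_one (by norm_num) (by norm_num) hk) ?_
        rw [← Finset.prod_const]
        exact Finset.prod_le_prod (fun _ _ => by norm_num) fun p hp => hfac p (hP p hp)
      calc (1 / 3 : ℝ) ^ 160 = ((1 / 3 : ℝ) ^ 40) ^ 4 := by rw [← pow_mul]
        _ ≤ (∏ p ∈ insert q P, ((p : ℝ) - 1) / (p + 1)) ^ 4 :=
          pow_le_pow_left₀ (by positivity) h1 4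
        _ ≤ _ := le_mul_of_one_le_right (by positivity) (one_le_pow₀ (le_max_left _ _))
    · rw [Finset.card_insert_of_notMem hqP] at hk hcard ⊢
      refine (ih fun p hp => hP p (Finset.mem_insert_of_mem hp)).trans ?_
      rw [Finset.prod_insert hqP, mul_pow]
      set k : ℝ := ((P.card + 1 : ℕ) : ℝ) with hkdef
      have hk' : (41 : ℝ) ≤ k := by rw [hkdef]; exact_mod_cast (by omega : 41 ≤ P.card + 1)
      have hPk : (P.card : ℝ) = k - 1 := by rw [hkdef]; push_cast; ring
      have hqk : 3 * k - 10 ≤ q := by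
        have : ((3 * (P.card + 1) : ℕ) : ℝ) ≤ ((q + 10 : ℕ) : ℝ) := by exact_mod_cast hcard
        push_cast at this
        rw [hkdef]; push_cast; linarith
      rw [hPk, max_eq_right (by linarith), max_eq_right (by linarith)]
      have hlam : 1 - 2 / (3 * k - 9) ≤ ((q : ℝ) - 1) / (q + 1) := by
        have : ((q : ℝ) - 1) / (q + 1) = 1 - 2 / (q + 1) := by
          have : (q : ℝ) + 1 ≠ 0 := by positivity
          field_simp
          ring
        rw [this]
        have : 2 / ((q : ℝ) + 1) ≤ 2 / (3 * k - 9) :=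
          div_le_div_of_nonneg_left (by norm_num) (by linarith) (by linarith)
        linarith
      have hx : 2 / (3 * k - 9) ≤ 1 := by
        rw [div_le_one (by linarith)]; linarith
      have hbern : 1 - 4 * (2 / (3 * k - 9)) ≤ (((q : ℝ) - 1) / (q + 1)) ^ 4 := by
        have h1 := one_add_mul_le_pow (a := -(2 / (3 * k - 9))) (by linarith) 4
        push_cast at h1
        refine le_trans ?_ (pow_le_pow_left₀ (by linarith) hlam 4)
        rw [sub_eq_add_neg (1 : ℝ) (2 / (3 * k - 9))]
        linarith
      -- The loss `8 / (3 * k - 9)` is about `(8/3) / k`, while the right to compare with `((k - 1)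
      -- / k) ^ 3` allows about `3 / k`. The remaining cubic is nonnegative for `k ≥ 41`.
      have hmain : (k - 1) ^ 3 ≤ (1 - 4 * (2 / (3 * k - 9))) * k ^ 3 := by
        have h9 : 0 < 3 * k - 9 := by linarith
        have : (1 - 4 * (2 / (3 * k - 9))) * k ^ 3 - (k - 1) ^ 3
            = (k ^ 3 - 36 * k ^ 2 + 30 * k - 9) / (3 * k - 9) := by
          field_simp
          ring
        have h2 : 0 ≤ (k ^ 3 - 36 * k ^ 2 + 30 * k - 9) / (3 * k - 9) := by
          apply div_nonneg _ h9.le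
          nlinarith [mul_nonneg (sq_nonneg k) (by linarith : 0 ≤ k - 41)]
        linarith
      calc (∏ p ∈ P, ((p : ℝ) - 1) / (p + 1)) ^ 4 * (k - 1) ^ 3
          ≤ (∏ p ∈ P, ((p : ℝ) - 1) / (p + 1)) ^ 4 * ((1 - 4 * (2 / (3 * k - 9))) * k ^ 3) :=
            mul_le_mul_of_nonneg_left hmain (by positivity)
        _ ≤ (∏ p ∈ P, ((p : ℝ) - 1) / (p + 1)) ^ 4 * ((((q : ℝ) - 1) / (q + 1)) ^ 4 * k ^ 3) := by
            refine mul_le_mul_of_nonneg_left ?_ (by positivity)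
            exact mul_le_mul_of_nonneg_right hbern (by positivity)
        _ = _ := by ring

/-- Sums of sawtooth functions of bounded square mean have boundedly many terms. -/
theorem exists_length_bound : ∃ B : ℕ, ∀ (s : ℕ) (c : Fin s → ℤ) (m : Fin s → ℕ),
    Function.Injective m → (∀ i, 0 < m i) → (∀ i, c i ≠ 0) → gcdForm Finset.univ c m = 3 →
    s ≤ B ∧ ∀ i, |c i| ≤ B := by
  -- With `X = ∑ c i ^ 2` and `π` the product, `π * X ≤ 3` and `3 ^ (-160) ≤ π ^ 4 * X ^ 3`, because
  -- the number of primes is at most `s ≤ X`. Eliminating `π` gives this bound for `X`.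
  refine ⟨81 * 3 ^ 160, fun s c m hinj hm hc hQ => ?_⟩
  obtain ⟨P, hP, hcard, hsep⟩ := exists_separating_primes m hinj Finset.univ fun i _ => hm i
  have h1 := gcdForm_lower_bound c m P hP Finset.univ (fun i _ => hm i) hsep
  have h2 := prod_primes_lower_bound P hP
  rw [hQ] at h1
  rw [Finset.card_univ, Fintype.card_fin] at hcard
  have hπ : 0 ≤ ∏ p ∈ P, ((p : ℝ) - 1) / (p + 1) := Finset.prod_nonneg fun p hp => by
    have : (1 : ℝ) < p := by exact_mod_cast (hP p hp).one_lt
    exact div_nonneg (by linarith) (by linarith)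
  set π := ∏ p ∈ P, ((p : ℝ) - 1) / (p + 1)
  set X := ∑ i, (c i : ℝ) ^ 2 with hX
  have hci : ∀ i, (1 : ℝ) ≤ (c i : ℝ) ^ 2 := fun i => by
    have : 1 ≤ c i ^ 2 := by
      have := sq_pos_of_ne_zero (hc i)
      omega
    exact_mod_cast this
  have hsX : (s : ℝ) ≤ X := by
    have := Finset.sum_le_sum fun i (_ : i ∈ (Finset.univ : Finset (Fin s))) => hci i
    simpa using this
  rcases Nat.eq_zero_or_pos s with rfl | hs
  · exact ⟨Nat.zero_le _, fun i => i.elim0⟩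
  have hs1 : (1 : ℝ) ≤ s := by exact_mod_cast hs
  have hX1 : 1 ≤ X := hs1.trans hsX
  have hmax : max 1 (P.card : ℝ) ≤ X :=
    max_le hX1 (le_trans (by exact_mod_cast hcard) hsX)
  have h3 : (1 / 3 : ℝ) ^ 160 * X ^ 4 ≤ 81 * X ^ 3 := by
    have e1 : (1 / 3 : ℝ) ^ 160 ≤ π ^ 4 * X ^ 3 := h2.trans
      (mul_le_mul_of_nonneg_left (pow_le_pow_left₀ (by positivity) hmax 3) (by positivity))
    have e2 : (π * X) ^ 4 ≤ 3 ^ 4 := pow_le_pow_left₀ (by positivity) h1 4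
    calc (1 / 3 : ℝ) ^ 160 * X ^ 4 ≤ (π ^ 4 * X ^ 3) * X ^ 4 :=
          mul_le_mul_of_nonneg_right e1 (by positivity)
      _ = (π * X) ^ 4 * X ^ 3 := by ring
      _ ≤ 3 ^ 4 * X ^ 3 := mul_le_mul_of_nonneg_right e2 (by positivity)
      _ = 81 * X ^ 3 := by norm_num
  have h4 : X ≤ 81 * 3 ^ 160 := by
    have h5 : (1 / 3 : ℝ) ^ 160 * X ≤ 81 := by
      refine le_of_mul_le_mul_right (a := X ^ 3) ?_ (by positivity)
      calc _ = (1 / 3 : ℝ) ^ 160 * X ^ 4 := by ring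
        _ ≤ _ := h3
    calc X = 3 ^ 160 * ((1 / 3 : ℝ) ^ 160 * X) := by
          rw [← mul_assoc, ← mul_pow]; norm_num
      _ ≤ 3 ^ 160 * 81 := mul_le_mul_of_nonneg_left h5 (by positivity)
      _ = _ := by ring
  have hB : ((81 * 3 ^ 160 : ℕ) : ℝ) = 81 * 3 ^ 160 := by norm_num
  constructor
  · have : (s : ℝ) ≤ ((81 * 3 ^ 160 : ℕ) : ℝ) := by
      rw [hB]; exact hsX.trans h4
    exact_mod_cast this
  · intro i
    have h5 : (c i : ℝ) ^ 2 ≤ X :=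
      Finset.single_le_sum (f := fun i => (c i : ℝ) ^ 2) (fun i _ => sq_nonneg _)
        (Finset.mem_univ i)
    have h6 : |(c i : ℝ)| ≤ (c i : ℝ) ^ 2 := by
      have : |c i| ≤ c i ^ 2 := by
        rw [← sq_abs]
        exact Int.le_self_sq |c i|
      exact_mod_cast this
    have : ((|c i| : ℤ) : ℝ) ≤ (((81 * 3 ^ 160 : ℕ) : ℤ) : ℝ) := by
      rw [Int.cast_natCast, hB, Int.cast_abs]; exact h6.trans (h5.trans h4)
    exact_mod_cast this

end LengthBound

/-! ### Behaviour on a grid and linear independence -/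

/-- As `m` divides `M`, all jumps of `saw (m x)` lie on the grid of spacing `1 / M`, and between
grid points the slope is `-m`. -/
theorem saw_div_add_eq {m q M : ℕ} (hq : 0 < q) (hm : 0 < m) (hM : m * q = M) (k : ℤ) {t : ℝ}
    (ht0 : 0 ≤ t) (ht : t < 1 / M) : saw (m * (k / M + t)) = saw (m * (k / M)) - m * t := by
  have hq' : (0 : ℝ) < q := by exact_mod_cast hq
  have hm' : (0 : ℝ) < m := by exact_mod_cast hm
  have hMr : (M : ℝ) = m * q := by rw [← hM]; push_cast; ring
  have h1 : (m : ℝ) * (k / M) = k / q := by rw [hMr]; field_simp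
  have hmod := Int.emod_lt_of_pos k (by exact_mod_cast hq : (0 : ℤ) < q)
  have hmod0 := Int.emod_nonneg k (by exact_mod_cast hq.ne' : (q : ℤ) ≠ 0)
  have hk := Int.emod_add_mul_ediv k q
  have hkr : (k : ℝ) = (k % q : ℤ) + q * (k / q : ℤ) := by exact_mod_cast hk.symm
  have hr : ((k % q : ℤ) : ℝ) + 1 ≤ q := by exact_mod_cast hmod
  have hr0 : (0 : ℝ) ≤ (k % q : ℤ) := by exact_mod_cast hmod0
  have hkq : (k : ℝ) / q = (k / q : ℤ) + (k % q : ℤ) / q := by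
    rw [hkr]; field_simp
    ring_nf
  have hmt : (m : ℝ) * t < 1 / q := by
    rw [hMr] at ht
    calc (m : ℝ) * t < m * (1 / (m * q)) := mul_lt_mul_of_pos_left ht hm'
      _ = 1 / q := by field_simp
  have hmt0 : 0 ≤ (m : ℝ) * t := by positivity
  have hle : ((k % q : ℤ) : ℝ) / q + 1 / q ≤ 1 := by
    rw [← add_div, div_le_one hq']; exact hr
  have hge : 0 ≤ ((k % q : ℤ) : ℝ) / q := by positivity
  rw [mul_add, h1, saw_eq, saw_eq]
  have hf1 : ⌊(k : ℝ) / q⌋ = k / q := by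
    rw [Int.floor_eq_iff]; constructor <;> linarith [one_div_pos.2 hq']
  have hf2 : ⌊(k : ℝ) / q + m * t⌋ = k / q := by
    rw [Int.floor_eq_iff]; constructor <;> linarith
  rw [hf1, hf2]; ring

/-- By right continuity, the value at `-(k + 1) / M` is minus the left limit at `(k + 1) / M`, which
follows from the value at `k / M` and the slope `-m`. -/
theorem saw_neg_succ_div {m q M : ℕ} (hq : 0 < q) (hm : 0 < m) (hM : m * q = M) (k : ℤ) :
    saw (m * -(((k + 1 : ℤ) : ℝ) / M)) = -saw (m * (k / M)) + m / M := by
  have hq' : (0 : ℝ) < q := by exact_mod_cast hq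
  have hm' : (0 : ℝ) < m := by exact_mod_cast hm
  have hMr : (M : ℝ) = m * q := by rw [← hM]; push_cast; ring
  have h1 : (m : ℝ) * (k / M) = k / q := by rw [hMr]; field_simp
  have h2 : (m : ℝ) * -(((k + 1 : ℤ) : ℝ) / M) = -(k / q) - 1 / q := by
    rw [hMr]; push_cast; field_simp; ring
  have h3 : (m : ℝ) / M = 1 / q := by rw [hMr]; field_simp
  have hmod := Int.emod_lt_of_pos k (by exact_mod_cast hq : (0 : ℤ) < q)
  have hmod0 := Int.emod_nonneg k (by exact_mod_cast hq.ne' : (q : ℤ) ≠ 0)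
  have hk := Int.emod_add_mul_ediv k q
  have hkr : (k : ℝ) = (k % q : ℤ) + q * (k / q : ℤ) := by exact_mod_cast hk.symm
  have hr : ((k % q : ℤ) : ℝ) + 1 ≤ q := by exact_mod_cast hmod
  have hr0 : (0 : ℝ) ≤ (k % q : ℤ) := by exact_mod_cast hmod0
  have hkq : (k : ℝ) / q = (k / q : ℤ) + (k % q : ℤ) / q := by
    rw [hkr]; field_simp
    ring_nf
  have hle : ((k % q : ℤ) : ℝ) / q + 1 / q ≤ 1 := by
    rw [← add_div, div_le_one hq']; exact hr
  have hge : 0 ≤ ((k % q : ℤ) : ℝ) / q := by positivity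
  have hq1 := one_div_pos.2 hq'
  have hf1 : ⌊(k : ℝ) / q⌋ = k / q := by
    rw [Int.floor_eq_iff]; constructor <;> linarith
  have hf2 : ⌊-((k : ℝ) / q) - 1 / q⌋ = -(k / q) - 1 := by
    rw [Int.floor_eq_iff]; push_cast; constructor <;> linarith
  rw [h1, h2, h3, saw_eq, saw_eq, hf1, hf2]; push_cast; ring

/-- A linear combination of dilated sawtooth functions. -/
noncomputable def sawFinsupp (w : ℕ →₀ ℤ) (x : ℝ) : ℝ := w.sum fun k a => (a : ℝ) * saw (k * x)

theorem sawFinsupp_add (v w : ℕ →₀ ℤ) (x : ℝ) :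
    sawFinsupp (v + w) x = sawFinsupp v x + sawFinsupp w x :=
  Finsupp.sum_add_index' (by simp) (by intros; push_cast; ring)

theorem sawFinsupp_neg (w : ℕ →₀ ℤ) (x : ℝ) : sawFinsupp (-w) x = -sawFinsupp w x := by
  rw [sawFinsupp, Finsupp.sum_neg_index (by simp), sawFinsupp, Finsupp.sum, Finsupp.sum,
    ← Finset.sum_neg_distrib]
  simp

theorem sawFinsupp_sub (v w : ℕ →₀ ℤ) (x : ℝ) :
    sawFinsupp (v - w) x = sawFinsupp v x - sawFinsupp w x := by
  rw [sub_eq_add_neg, sawFinsupp_add, sawFinsupp_neg, sub_eq_add_neg]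

theorem sawFinsupp_single (k : ℕ) (a : ℤ) (x : ℝ) :
    sawFinsupp (Finsupp.single k a) x = a * saw (k * x) := by
  simp [sawFinsupp]

theorem fract_natCast_mul_one_div_ne_zero {l k : ℕ} (hl : 0 < l) (hlk : l < k) :
    Int.fract ((l : ℝ) * (1 / k)) ≠ 0 := by
  have hk : (0 : ℝ) < k := by exact_mod_cast hl.trans hlk
  have hl' : (0 : ℝ) < l := by exact_mod_cast hl
  have h : (l : ℝ) * (1 / k) < 1 := by
    rw [mul_one_div, div_lt_one hk]; exact_mod_cast hlk
  rw [Int.fract_eq_self.2 ⟨by positivity, h⟩]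
  positivity

/-- The dilated sawtooth functions are linearly independent. -/
theorem eq_zero_of_sawFinsupp_eq_zero {w : ℕ →₀ ℤ} (h0 : w 0 = 0)
    (h : ∀ x, sawFinsupp w x = 0) : w = 0 := by
  by_contra hw
  have hne : w.support.Nonempty := Finsupp.support_nonempty_iff.2 hw
  set k := w.support.max' hne with hk
  have hkmem : k ∈ w.support := Finset.max'_mem _ _
  have hk0 : 0 < k := Nat.pos_of_ne_zero fun h => by
    rw [h, Finsupp.mem_support_iff] at hkmem; exact hkmem h0
  -- Among dilations `0 < l ≤ k`, only `l = k` has a jump at `1 / k`, so the even part there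
  -- isolates the top coefficient.
  have h1 : sawFinsupp w (1 / k) + sawFinsupp w (-(1 / k)) = w k := by
    rw [sawFinsupp, sawFinsupp, Finsupp.sum, Finsupp.sum, ← Finset.sum_add_distrib,
      Finset.sum_eq_single_of_mem k hkmem]
    · have : (k : ℝ) ≠ 0 := by exact_mod_cast hk0.ne'
      rw [← mul_add, mul_neg, saw_add_saw_neg, mul_one_div_cancel this]
      simp
    · intro l hl hlk
      have hl0 : 0 < l := Nat.pos_of_ne_zero fun h => by
        rw [h, Finsupp.mem_support_iff] at hl; exact hl h0
      have hlt : l < k := lt_of_le_of_ne (Finset.le_max' _ _ hl) hlk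
      rw [← mul_add, mul_neg, saw_add_saw_neg,
        if_neg (fract_natCast_mul_one_div_ne_zero hl0 hlt), mul_zero]
  rw [h, h, add_zero] at h1
  exact Finsupp.mem_support_iff.1 hkmem (by exact_mod_cast h1.symm)

/-! ### Structure of almost odd sawtooth sums -/

section Weights

variable {ι : Type*}

/-- The weights `c i` placed at the dilations `m i`. -/
noncomputable def weightFinsupp (I : Finset ι) (c : ι → ℤ) (m : ι → ℕ) : ℕ →₀ ℤ :=
  ∑ i ∈ I, Finsupp.single (m i) (c i)

theorem sawFinsupp_weightFinsupp (I : Finset ι) (c : ι → ℤ) (m : ι → ℕ) (x : ℝ) :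
    sawFinsupp (weightFinsupp I c m) x = sawSum I c m x := by
  classical
  rw [weightFinsupp, sawSum]
  induction I using Finset.induction_on with
  | empty => simp [sawFinsupp]
  | insert i I hi ih =>
    rw [Finset.sum_insert hi, Finset.sum_insert hi, sawFinsupp_add, ih, sawFinsupp_single]

theorem weightFinsupp_apply_zero {I : Finset ι} {c : ι → ℤ} {m : ι → ℕ}
    (hm : ∀ i ∈ I, 0 < m i) : weightFinsupp I c m 0 = 0 := by
  rw [weightFinsupp, Finsupp.finsetSum_apply]
  exact Finset.sum_eq_zero fun i hi => Finsupp.single_eq_of_ne (hm i hi).ne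

theorem sawSum_neg_weights (I : Finset ι) (c : ι → ℤ) (m : ι → ℕ) (x : ℝ) :
    sawSum I (fun i => -c i) m x = -sawSum I c m x := by
  simp [sawSum]

theorem sawSum_add_intCast (I : Finset ι) (c : ι → ℤ) (m : ι → ℕ) (x : ℝ) (k : ℤ) :
    sawSum I c m (x + k) = sawSum I c m x := by
  refine Finset.sum_congr rfl fun i _ => ?_
  have : (m i : ℝ) * (x + k) = m i * x + ((m i * k : ℤ) : ℝ) := by push_cast; ring
  rw [this, saw_add_intCast]

theorem exists_sawSum_eq_linear (I : Finset ι) (c : ι → ℤ) (m : ι → ℕ) (x : ℝ) :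
    ∃ z : ℤ, sawSum I c m x
      = ((∑ i ∈ I, c i : ℤ) : ℝ) / 2 - ((∑ i ∈ I, c i * m i : ℤ) : ℝ) * x + z := by
  refine ⟨∑ i ∈ I, c i * ⌊(m i : ℝ) * x⌋, ?_⟩
  push_cast
  rw [Finset.sum_div, Finset.sum_mul, ← Finset.sum_sub_distrib, ← Finset.sum_add_distrib]
  refine Finset.sum_congr rfl fun i _ => ?_
  rw [saw_eq]; ring

section Structure

variable {I : Finset ι} {c : ι → ℤ} {m : ι → ℕ}

theorem sawSum_div_add (hm : ∀ i ∈ I, 0 < m i) (k : ℤ) {t : ℝ} (ht0 : 0 ≤ t)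
    (ht : t < 1 / (∏ i ∈ I, m i : ℕ)) :
    sawSum I c m (k / (∏ i ∈ I, m i : ℕ) + t)
      = sawSum I c m (k / (∏ i ∈ I, m i : ℕ)) - ((∑ i ∈ I, c i * m i : ℤ) : ℝ) * t := by
  classical
  simp only [sawSum]
  push_cast only [Int.cast_sum]
  rw [Finset.sum_mul, ← Finset.sum_sub_distrib]
  refine Finset.sum_congr rfl fun i hi => ?_
  rw [saw_div_add_eq (Finset.prod_pos fun j hj => hm j (Finset.mem_of_mem_erase hj)) (hm i hi)
    (Finset.mul_prod_erase I m hi) k ht0 ht]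
  push_cast; ring

theorem sawSum_neg_succ_div (hm : ∀ i ∈ I, 0 < m i) (k : ℤ) :
    sawSum I c m (-(((k + 1 : ℤ) : ℝ) / (∏ i ∈ I, m i : ℕ)))
      = -sawSum I c m (k / (∏ i ∈ I, m i : ℕ))
        + ((∑ i ∈ I, c i * m i : ℤ) : ℝ) / (∏ i ∈ I, m i : ℕ) := by
  classical
  simp only [sawSum]
  push_cast only [Int.cast_sum]
  rw [Finset.sum_div, ← Finset.sum_neg_distrib, ← Finset.sum_add_distrib]
  refine Finset.sum_congr rfl fun i hi => ?_
  rw [saw_neg_succ_div (Finset.prod_pos fun j hj => hm j (Finset.mem_of_mem_erase hj)) (hm i hi)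
    (Finset.mul_prod_erase I m hi) k]
  push_cast; ring

/-- At `1 / m i` with `m i` the largest dilation, only the `i`-th term fails to be odd, and it
contributes `c i ≠ 0`. -/
theorem exists_sawSum_jump (hm : ∀ i ∈ I, 0 < m i) (hinj : Set.InjOn m I) (hne : I.Nonempty)
    (hc : ∀ i ∈ I, c i ≠ 0) :
    ∃ k : ℤ, sawSum I c m (-(k / (∏ i ∈ I, m i : ℕ))) ≠ -sawSum I c m (k / (∏ i ∈ I, m i : ℕ)) := by
  classical
  obtain ⟨i, hi, hmax⟩ := Finset.exists_max_image I m hne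
  have hmi : (m i : ℝ) ≠ 0 := by exact_mod_cast (hm i hi).ne'
  have hpe : ((∏ j ∈ I.erase i, m j : ℕ) : ℝ) ≠ 0 := by
    exact_mod_cast (Finset.prod_pos fun j hj => hm j (Finset.mem_of_mem_erase hj)).ne'
  refine ⟨(∏ j ∈ I.erase i, m j : ℕ), fun h => hc i hi ?_⟩
  have hx : (((∏ j ∈ I.erase i, m j : ℕ) : ℤ) : ℝ) / (∏ j ∈ I, m j : ℕ) = 1 / m i := by
    rw [← Finset.mul_prod_erase I m hi, Int.cast_natCast, Nat.cast_mul]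
    field_simp
  rw [hx] at h
  have h1 : sawSum I c m (1 / m i) + sawSum I c m (-(1 / m i)) = c i := by
    rw [sawSum, sawSum, ← Finset.sum_add_distrib, Finset.sum_eq_single_of_mem i hi]
    · rw [← mul_add, mul_neg, saw_add_saw_neg, mul_one_div_cancel hmi]
      simp
    · intro l hl hli
      have hlt : m l < m i := lt_of_le_of_ne (hmax l hl) fun h => hli (hinj hl hi h)
      rw [← mul_add, mul_neg, saw_add_saw_neg,
        if_neg (fract_natCast_mul_one_div_ne_zero (hm l hl) hlt), mul_zero]
  rw [h, add_neg_cancel] at h1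
  exact_mod_cast h1.symm

/-- Start at a grid point where oddness fails, so that the value is `±1/2`, and move right. At each
grid point the value is either reset to `±1/2` or, by oddness, continues the preceding affine piece,
whose slope `-∑ c i * m i` is nonpositive. -/
theorem sawSum_le_half (hm : ∀ i ∈ I, 0 < m i) (hinj : Set.InjOn m I) (hne : I.Nonempty)
    (hc : ∀ i ∈ I, c i ≠ 0)
    (H : ∀ s, sawSum I c m (-s) = -sawSum I c m s ∨ (sawSum I c m (-s) = sawSum I c m s ∧
      (sawSum I c m s = 1 / 2 ∨ sawSum I c m s = -(1 / 2))))
    (hσ : 0 ≤ ∑ i ∈ I, c i * m i) (s : ℝ) : sawSum I c m s ≤ 1 / 2 := by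
  set M : ℕ := ∏ i ∈ I, m i with hM
  have hM0 : 0 < M := Finset.prod_pos hm
  have hM' : (0 : ℝ) < M := by exact_mod_cast hM0
  have hσ' : (0 : ℝ) ≤ ((∑ i ∈ I, c i * m i : ℤ) : ℝ) := by exact_mod_cast hσ
  obtain ⟨k₀, hk₀⟩ := exists_sawSum_jump hm hinj hne hc
  rw [← hM] at hk₀
  have hfwd : ∀ n : ℕ, sawSum I c m (((k₀ + n : ℤ) : ℝ) / M) ≤ 1 / 2 := by
    intro n
    induction n with
    | zero =>
      rcases H (k₀ / M) with h | ⟨-, h | h⟩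
      · exact (hk₀ h).elim
      · simp [h]
      · simp only [Nat.cast_zero, add_zero, h]; norm_num
    | succ n ih =>
      have h1 := sawSum_neg_succ_div (c := c) hm (k₀ + n)
      rw [← hM] at h1
      have e : (k₀ + (n + 1 : ℕ) : ℤ) = k₀ + n + 1 := by push_cast; ring
      rw [e]
      rcases H (((k₀ + n + 1 : ℤ) : ℝ) / M) with h | ⟨-, h | h⟩
      · rw [h1] at h
        have : 0 ≤ ((∑ i ∈ I, c i * m i : ℤ) : ℝ) / M := by positivity
        linarith
      · exact h.le
      · rw [h]; norm_num
  have hall : ∀ k : ℤ, sawSum I c m ((k : ℝ) / M) ≤ 1 / 2 := by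
    intro k
    -- Shifting by the integer `|k - k₀|`, a period, moves any grid point to the right of `k₀ / M`.
    have h1 := hfwd (k - k₀ + |k - k₀| * M).toNat
    have h2 : 0 ≤ k - k₀ + |k - k₀| * M := by
      have h3 : |k - k₀| ≤ |k - k₀| * M :=
        le_mul_of_one_le_right (abs_nonneg _) (by exact_mod_cast hM0)
      have := neg_abs_le (k - k₀)
      linarith
    rw [Int.toNat_of_nonneg h2] at h1
    have e : ((k₀ + (k - k₀ + |k - k₀| * M) : ℤ) : ℝ) / M = k / M + (|k - k₀| : ℤ) := by
      push_cast; field_simp; ring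
    rwa [e, sawSum_add_intCast] at h1
  have hs : s = ((⌊s * M⌋ : ℤ) : ℝ) / M + Int.fract (s * M) / M := by
    rw [← add_div, Int.floor_add_fract, mul_div_cancel_right₀ _ hM'.ne']
  have hfr0 : 0 ≤ Int.fract (s * M) / M := div_nonneg (Int.fract_nonneg _) hM'.le
  have hfr1 : Int.fract (s * M) / M < 1 / M := div_lt_div_of_pos_right (Int.fract_lt_one _) hM'
  rw [hs, hM, sawSum_div_add hm _ hfr0 hfr1]
  have := hall ⌊s * M⌋
  have := mul_nonneg hσ' hfr0
  rw [← hM]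
  linarith

/-- Modulo `1` the sum is affine of slope `-σ`, where `σ = ∑ c i * m i`, and it stays in `[-1/2,
1/2]`. If `σ = 0`, the jump point shows that all values lie in `1/2 + ℤ`. If `σ > 0`, the sum is
`saw` of an affine function, and linear independence identifies the weights. -/
theorem weightFinsupp_structure_of_nonneg (hm : ∀ i ∈ I, 0 < m i) (hinj : Set.InjOn m I)
    (hne : I.Nonempty) (hc : ∀ i ∈ I, c i ≠ 0)
    (H : ∀ s, sawSum I c m (-s) = -sawSum I c m s ∨ (sawSum I c m (-s) = sawSum I c m s ∧
      (sawSum I c m s = 1 / 2 ∨ sawSum I c m s = -(1 / 2))))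
    (hσ : 0 ≤ ∑ i ∈ I, c i * m i) :
    (∀ s, sawSum I c m s = 1 / 2 ∨ sawSum I c m s = -(1 / 2)) ∨
    ∃ N : ℕ, 0 < N ∧ (weightFinsupp I c m = Finsupp.single N 1 ∨
      weightFinsupp I c m = Finsupp.single (2 * N) 1 - Finsupp.single N 1) := by
  have hle := sawSum_le_half hm hinj hne hc H hσ
  have hge : ∀ s, -(1 / 2) ≤ sawSum I c m s := by
    intro s
    rcases H s with h | ⟨-, h | h⟩
    · have := hle (-s); linarith
    · rw [h]; norm_num
    · exact h.ge
  obtain ⟨k₀, hk₀⟩ := exists_sawSum_jump hm hinj hne hc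
  set M : ℕ := ∏ i ∈ I, m i with hM
  have hM0 : 0 < M := Finset.prod_pos hm
  have hM' : (0 : ℝ) < M := by exact_mod_cast hM0
  have hjump := (H (k₀ / M)).resolve_left hk₀
  obtain ⟨σ, hσdef⟩ : ∃ σ, σ = ∑ i ∈ I, c i * m i := ⟨_, rfl⟩
  obtain ⟨n, hn⟩ : ∃ n, n = ∑ i ∈ I, c i := ⟨_, rfl⟩
  have hlin := exists_sawSum_eq_linear I c m
  rw [← hσdef, ← hn] at hlin
  rw [← hσdef] at hσ
  obtain ⟨z₀, hz₀⟩ := hlin (k₀ / M)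
  obtain ⟨z₁, hz₁⟩ : ∃ z₁ : ℤ, (n : ℝ) / 2 - σ * (k₀ / M) = 1 / 2 + z₁ := by
    rcases hjump.2 with h | h
    · exact ⟨-z₀, by push_cast; linarith⟩
    · exact ⟨-z₀ - 1, by push_cast; linarith⟩
  rcases hσ.eq_or_lt with h0 | hpos
  · left
    intro s
    obtain ⟨z, hz⟩ := hlin s
    rw [← h0] at hz hz₁
    have hz' : sawSum I c m s = 1 / 2 + ((z₁ + z : ℤ) : ℝ) := by
      push_cast at hz hz₁ ⊢; linarith
    have h1 := hle s
    have h2 := hge s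
    rw [hz'] at h1 h2 ⊢
    have h3 : z₁ + z ≤ 0 := by
      have : ((z₁ + z : ℤ) : ℝ) ≤ 0 := by linarith
      exact_mod_cast this
    have h4 : -1 ≤ z₁ + z := by
      have : (-1 : ℝ) ≤ ((z₁ + z : ℤ) : ℝ) := by linarith
      exact_mod_cast this
    obtain h5 | h5 : z₁ + z = 0 ∨ z₁ + z = -1 := by omega
    · left; rw [h5]; norm_num
    · right; rw [h5]; norm_num
  · right
    have hσ' : (0 : ℝ) < σ := by exact_mod_cast hpos
    have hfg : ∀ s, sawSum I c m s = saw (σ * s - (n - 1) / 2) := by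
      intro s
      obtain ⟨z, hz⟩ := hlin s
      have hg := saw_eq (σ * s - (n - 1) / 2)
      have hg1 := saw_le (σ * s - (n - 1) / 2)
      have hg2 := neg_half_lt_saw (σ * s - (n - 1) / 2)
      set g := saw (σ * s - (n - 1) / 2)
      obtain ⟨y, hy⟩ : ∃ y : ℤ, sawSum I c m s = g + y :=
        ⟨z - ⌊σ * s - ((n : ℝ) - 1) / 2⌋, by push_cast; linarith⟩
      have hy1 : y < 1 := by
        have : (y : ℝ) < 1 := by linarith [hle s]
        exact_mod_cast this
      have hy2 : -1 ≤ y := by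
        have : (-1 : ℝ) ≤ y := by linarith [hge s]
        exact_mod_cast this
      obtain h | h : y = 0 ∨ y = -1 := by omega
      · rw [hy, h]; simp
      -- Here the value would be `-1/2`; as the slope is negative, the sum would drop below `-1/2`
      -- immediately to the right.
      · exfalso
        have hbot : sawSum I c m s = -(1 / 2) := by
          apply le_antisymm _ (hge s)
          rw [hy, h]; push_cast; linarith
        have hs : s = ((⌊s * M⌋ : ℤ) : ℝ) / M + Int.fract (s * M) / M := by
          rw [← add_div, Int.floor_add_fract, mul_div_cancel_right₀ _ hM'.ne']
        have hfr0 : 0 ≤ Int.fract (s * M) / M := div_nonneg (Int.fract_nonneg _) hM'.le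
        have hfr1 : Int.fract (s * M) / M < 1 / M :=
          div_lt_div_of_pos_right (Int.fract_lt_one _) hM'
        have e1 := sawSum_div_add (c := c) hm ⌊s * M⌋ hfr0 hfr1
        have e2 := sawSum_div_add (c := c) hm ⌊s * M⌋
          (t := (Int.fract (s * M) / M + 1 / M) / 2) (by positivity) (by rw [← hM]; linarith)
        rw [← hM, ← hσdef] at e1 e2
        rw [← hs, hbot] at e1
        have e3 := hge (((⌊s * M⌋ : ℤ) : ℝ) / M + (Int.fract (s * M) / M + 1 / M) / 2)
        rw [e2] at e3
        have e4 : σ * (Int.fract (s * M) / M) < σ * ((Int.fract (s * M) / M + 1 / M) / 2) :=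
          mul_lt_mul_of_pos_left (by linarith) hσ'
        linarith
    obtain ⟨N, rfl⟩ := Int.eq_ofNat_of_zero_le hσ
    have hN : 0 < N := by exact_mod_cast hpos
    refine ⟨N, hN, ?_⟩
    have hw0 := weightFinsupp_apply_zero (c := c) hm
    have hN0 : ∀ a : ℤ, Finsupp.single N a 0 = 0 := fun a => Finsupp.single_eq_of_ne hN.ne
    have h2N0 : ∀ a : ℤ, Finsupp.single (2 * N) a 0 = 0 :=
      fun a => Finsupp.single_eq_of_ne (by omega)
    -- For `n` odd the translation `(n - 1) / 2` is integral. For `n` even it is half-integral, and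
    -- `saw (N x + 1/2) = saw (2 N x) - saw (N x)`.
    rcases Int.even_or_odd' n with ⟨j, hj | hj⟩
    · right
      rw [← sub_eq_zero]
      apply eq_zero_of_sawFinsupp_eq_zero
      · simp only [Finsupp.sub_apply, hw0, hN0, h2N0]; norm_num
      · intro x
        rw [sawFinsupp_sub, sawFinsupp_sub, sawFinsupp_weightFinsupp, sawFinsupp_single,
          sawFinsupp_single, hfg, hj]
        have e : ((N : ℤ) : ℝ) * x - (((2 * j : ℤ) : ℝ) - 1) / 2
            = N * x + 1 / 2 + ((-j : ℤ) : ℝ) := by push_cast; ring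
        have h2 := sum_saw_add_div 2 two_pos (N * x)
        simp only [Finset.sum_range_succ, Finset.sum_range_zero] at h2
        rw [e, saw_add_intCast]
        push_cast at h2 ⊢
        rw [mul_assoc, ← h2]
        simp
    · left
      rw [← sub_eq_zero]
      apply eq_zero_of_sawFinsupp_eq_zero
      · simp only [Finsupp.sub_apply, hw0, hN0]; norm_num
      · intro x
        rw [sawFinsupp_sub, sawFinsupp_weightFinsupp, sawFinsupp_single, hfg, hj]
        have e : ((N : ℤ) : ℝ) * x - (((2 * j + 1 : ℤ) : ℝ) - 1) / 2
            = N * x + ((-j : ℤ) : ℝ) := by push_cast; ring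
        rw [e, saw_add_intCast]
        simp

theorem weightFinsupp_neg (I : Finset ι) (c : ι → ℤ) (m : ι → ℕ) :
    weightFinsupp I (fun i => -c i) m = -weightFinsupp I c m := by
  simp [weightFinsupp]

/-- A sum of dilated sawtooth functions that is odd except at points where it equals `±1/2` is
either a step function with values `±1/2`, or a single sawtooth function, up to sign and a
half-integral translation. -/
theorem weightFinsupp_structure (hm : ∀ i ∈ I, 0 < m i) (hinj : Set.InjOn m I)
    (hne : I.Nonempty) (hc : ∀ i ∈ I, c i ≠ 0)
    (H : ∀ s, sawSum I c m (-s) = -sawSum I c m s ∨ (sawSum I c m (-s) = sawSum I c m s ∧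
      (sawSum I c m s = 1 / 2 ∨ sawSum I c m s = -(1 / 2)))) :
    (∀ s, sawSum I c m s = 1 / 2 ∨ sawSum I c m s = -(1 / 2)) ∨
    ∃ (N : ℕ) (ε : ℤ), 0 < N ∧ (ε = 1 ∨ ε = -1) ∧ (weightFinsupp I c m = Finsupp.single N ε ∨
      weightFinsupp I c m = Finsupp.single (2 * N) ε - Finsupp.single N ε) := by
  rcases le_total 0 (∑ i ∈ I, c i * m i) with hσ | hσ
  · rcases weightFinsupp_structure_of_nonneg hm hinj hne hc H hσ with h | ⟨N, hN, h⟩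
    · exact Or.inl h
    · exact Or.inr ⟨N, 1, hN, Or.inl rfl, h⟩
  · have h := weightFinsupp_structure_of_nonneg (c := fun i => -c i) hm hinj hne
      (fun i hi => neg_ne_zero.2 (hc i hi)) (fun s => by
        simp only [sawSum_neg_weights]
        rcases H s with h | ⟨h1, h2⟩
        · left; rw [h]
        · right
          refine ⟨by rw [h1], ?_⟩
          rcases h2 with h | h
          · right; rw [h]
          · left; rw [h, neg_neg])
      (by simpa only [neg_mul, Finset.sum_neg_distrib, Left.nonneg_neg_iff] using hσ)
    simp only [sawSum_neg_weights, weightFinsupp_neg] at h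
    rcases h with h | ⟨N, hN, h⟩
    · left
      intro s
      rcases h s with h | h
      · right; linarith
      · left; linarith
    · right
      refine ⟨N, -1, hN, Or.inr rfl, ?_⟩
      rcases h with h | h
      · left
        rw [← neg_neg (weightFinsupp I c m), h, Finsupp.single_neg]
      · right
        rw [← neg_neg (weightFinsupp I c m), h, Finsupp.single_neg, Finsupp.single_neg]
        abel

/-- For the half-translated sawtooth the value is `1 + 1 - 2 * (1/2)`, the kernel at `(2 N, N)`
being `1/2`. -/
theorem gcdForm_eq_one (hm : ∀ i ∈ I, 0 < m i) {N : ℕ} {ε : ℤ} (hN : 0 < N)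
    (hε : ε = 1 ∨ ε = -1) (h : weightFinsupp I c m = Finsupp.single N ε ∨
      weightFinsupp I c m = Finsupp.single (2 * N) ε - Finsupp.single N ε) :
    gcdForm I c m = 1 := by
  have hε2 : (ε : ℝ) ^ 2 = 1 := by rcases hε with rfl | rfl <;> norm_num
  have hNr : (N : ℝ) ≠ 0 := by exact_mod_cast hN.ne'
  have hk1 : gcdKernel N N = 1 := by
    rw [gcdKernel, Nat.gcd_self]; field_simp
  have hf := sawFinsupp_weightFinsupp I c m
  rw [gcdForm_eq_integral I c m hm]
  rcases h with h | h
  · have : ∀ x, sawSum I c m x ^ 2 = saw (N * x) * saw (N * x) := by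
      intro x
      rw [← hf, h, sawFinsupp_single, mul_pow, hε2]; ring
    simp only [this]
    rw [integral_saw_mul_saw hN hN, hk1]; norm_num
  · have h2N : 0 < 2 * N := by omega
    have hk2 : gcdKernel (2 * N) (2 * N) = 1 := by
      rw [gcdKernel, Nat.gcd_self]; push_cast; field_simp
    have hk3 : gcdKernel (2 * N) N = 1 / 2 := by
      rw [gcdKernel, Nat.gcd_mul_left_left]; push_cast; field_simp
    have : ∀ x, sawSum I c m x ^ 2 = saw ((2 * N : ℕ) * x) * saw ((2 * N : ℕ) * x)
        + saw (N * x) * saw (N * x) - 2 * (saw ((2 * N : ℕ) * x) * saw (N * x)) := by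
      intro x
      rw [← hf, h, sawFinsupp_sub, sawFinsupp_single, sawFinsupp_single, ← mul_sub, mul_pow, hε2]
      ring
    simp only [this]
    have i1 := intervalIntegrable_saw_mul_saw (2 * N : ℕ) (2 * N : ℕ) 0 1
    have i2 := intervalIntegrable_saw_mul_saw N N 0 1
    have i3 := (intervalIntegrable_saw_mul_saw (2 * N : ℕ) N 0 1).const_mul 2
    rw [intervalIntegral.integral_sub (i1.add i2) i3, intervalIntegral.integral_add i1 i2,
      intervalIntegral.integral_const_mul, integral_saw_mul_saw h2N h2N, integral_saw_mul_saw hN hN,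
      integral_saw_mul_saw h2N hN, hk1, hk2, hk3]
    norm_num

end Structure

end Weights

/-! ### Sawtooth sums of linear forms on the plane -/

theorem integral_saw_affine (α : ℝ) {d : ℤ} (hd : d ≠ 0) :
    ∫ z in (0 : ℝ)..1, saw (α + d * z) = 0 := by
  have hd' : (d : ℝ) ≠ 0 := by exact_mod_cast hd
  have hper : Function.Periodic saw 1 := fun x => by
    have := saw_add_intCast x 1
    simpa using this
  have hi : ∀ a b, IntervalIntegrable saw MeasureTheory.volume a b :=
    intervalIntegrable_of_abs_le measurable_saw abs_saw_le
  have h01 : ∫ x in (0 : ℝ)..1, saw x = 0 := by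
    have : ∫ x in (0 : ℝ)..1, saw x = ∫ x in (0 : ℝ)..1, (1 / 2 - x) := by
      apply intervalIntegral.integral_congr_ae
      have h1 : ∀ᵐ x : ℝ, x ≠ 1 := by simp [MeasureTheory.ae_iff]
      filter_upwards [h1] with x hx1 hx
      rw [Set.uIoc_of_le zero_le_one] at hx
      rw [saw, Int.fract_eq_self.2 ⟨hx.1.le, lt_of_le_of_ne hx.2 hx1⟩]
    rw [this, intervalIntegral.integral_sub (by simp) (by simp)]
    norm_num
  have h1 : ∫ z in (0 : ℝ)..1, saw (α + d * z) = ∫ z in (0 : ℝ)..1, saw (d * z + α) := by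
    simp only [add_comm]
  rw [h1, intervalIntegral.integral_comp_mul_add _ hd']
  have h2 := hper.intervalIntegral_add_zsmul_eq d α hi
  rw [hper.intervalIntegral_add_eq α 0, zero_add, h01, smul_zero, zsmul_one, add_comm] at h2
  simp only [mul_zero, zero_add, mul_one]
  rw [h2, smul_zero]

theorem ae_fract_affine_ne_zero (α : ℝ) {d : ℤ} (hd : d ≠ 0) :
    ∀ᵐ z : ℝ, Int.fract (α + d * z) ≠ 0 := by
  have hd' : (d : ℝ) ≠ 0 := by exact_mod_cast hd
  have hcount : (Set.range fun k : ℤ => ((k : ℝ) - α) / d).Countable := Set.countable_range _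
  filter_upwards [hcount.ae_notMem MeasureTheory.volume] with z hz h
  obtain ⟨k, hk⟩ := Int.fract_eq_zero_iff.1 h
  exact hz ⟨k, by simp only [hk]; field_simp; ring⟩

theorem gcdKernel_nonneg (m n : ℕ) : 0 ≤ gcdKernel m n := by
  rw [gcdKernel]; positivity

theorem gcdKernel_eq_of_proportional {m₁ m₂ n₁ n₂ : ℕ} (hm₁ : 0 < m₁) (hm₂ : 0 < m₂)
    (hn₁ : 0 < n₁) (hn₂ : 0 < n₂) (h : n₁ * m₂ = n₂ * m₁) :
    gcdKernel n₁ n₂ = gcdKernel m₁ m₂ := by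
  have h2 : m₂ * Nat.gcd n₁ n₂ = n₂ * Nat.gcd m₁ m₂ := by
    rw [← Nat.gcd_mul_left, ← Nat.gcd_mul_left, mul_comm m₂ n₁, h, mul_comm m₂ n₂]
  have h1 : m₁ * Nat.gcd n₁ n₂ = n₁ * Nat.gcd m₁ m₂ := by
    rw [← Nat.gcd_mul_left, ← Nat.gcd_mul_left, h, mul_comm m₁ n₁, mul_comm m₁ n₂]
  have h1' : (m₁ : ℝ) * Nat.gcd n₁ n₂ = n₁ * Nat.gcd m₁ m₂ := by exact_mod_cast h1
  have h2' : (m₂ : ℝ) * Nat.gcd n₁ n₂ = n₂ * Nat.gcd m₁ m₂ := by exact_mod_cast h2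
  rw [gcdKernel, gcdKernel, div_eq_div_iff (by positivity) (by positivity)]
  linear_combination (m₂ * (Nat.gcd n₁ n₂ : ℝ)) * h1' + (n₁ * (Nat.gcd m₁ m₂ : ℝ)) * h2'

-- The gcd of the two translates divides the determinant `b i * m j - b j * m i`. If this is
-- nonzero, the gcd stays bounded while the product grows. If it vanishes, the pairs are
-- proportional and have equal kernels.
open Filter in
theorem tendsto_gcdKernel_translate {ι : Type*} {m : ι → ℕ} {b : ι → ℤ} (hm : ∀ i, 0 < m i)
    (i j : ι) :
    Tendsto (fun M : ℕ => gcdKernel (M * m i + b i).toNat (M * m j + b j).toNat) atTop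
      (nhds (if (b i : ℚ) / m i = (b j : ℚ) / m j then gcdKernel (m i) (m j) else 0)) := by
  have hpos : ∀ i, ∀ᶠ M : ℕ in atTop, (M : ℤ) - |b i| ≤ M * m i + b i ∧ 0 < (M : ℤ) * m i + b i := by
    intro i
    filter_upwards [eventually_gt_atTop (|b i|).toNat] with M hM
    have h1 : (M : ℤ) ≤ M * m i := le_mul_of_one_le_right (by positivity) (by exact_mod_cast hm i)
    have h2 := neg_abs_le (b i)
    constructor <;> omega
  split_ifs with h
  · apply tendsto_const_nhds.congr'
    filter_upwards [hpos i, hpos j] with M hi hj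
    refine (gcdKernel_eq_of_proportional (hm i) (hm j) (by omega) (by omega) ?_).symm
    have hi' : (m i : ℚ) ≠ 0 := by exact_mod_cast (hm i).ne'
    have hj' : (m j : ℚ) ≠ 0 := by exact_mod_cast (hm j).ne'
    rw [div_eq_div_iff hi' hj'] at h
    have h' : b i * m j = b j * m i := by exact_mod_cast h
    zify
    rw [Int.toNat_of_nonneg hi.2.le, Int.toNat_of_nonneg hj.2.le]
    linear_combination h'
  · set D : ℤ := |b i * m j - b j * m i| with hD
    have hD0 : b i * m j - b j * m i ≠ 0 := by
      intro h0
      apply h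
      have hi' : (m i : ℚ) ≠ 0 := by exact_mod_cast (hm i).ne'
      have hj' : (m j : ℚ) ≠ 0 := by exact_mod_cast (hm j).ne'
      rw [div_eq_div_iff hi' hj']
      exact_mod_cast sub_eq_zero.1 h0
    have hlim : Tendsto (fun M : ℕ => (D : ℝ) ^ 2 / ((M : ℝ) - (|b i| : ℤ))) atTop (nhds 0) :=
      tendsto_const_nhds.div_atTop
        (tendsto_atTop_add_const_right _ _ tendsto_natCast_atTop_atTop)
    refine squeeze_zero' (Eventually.of_forall fun _ => gcdKernel_nonneg _ _) ?_ hlim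
    filter_upwards [hpos i, hpos j, eventually_gt_atTop (|b i|).toNat] with M hi hj hM
    set p := (M * m i + b i).toNat with hp
    set q := (M * m j + b j).toNat with hq
    have hp' : (p : ℤ) = M * m i + b i := Int.toNat_of_nonneg hi.2.le
    have hq' : (q : ℤ) = M * m j + b j := Int.toNat_of_nonneg hj.2.le
    have hdvd : ((Nat.gcd p q : ℕ) : ℤ) ∣ b i * m j - b j * m i := by
      have e : b i * m j - b j * m i = p * m j - q * m i := by rw [hp', hq']; ring
      rw [e]
      exact dvd_sub ((Int.natCast_dvd_natCast.2 (Nat.gcd_dvd_left p q)).mul_right _)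
        ((Int.natCast_dvd_natCast.2 (Nat.gcd_dvd_right p q)).mul_right _)
    have hgD : ((Nat.gcd p q : ℕ) : ℤ) ≤ D :=
      Int.le_of_dvd (abs_pos.2 hD0) ((dvd_abs _ _).2 hdvd)
    have hgD' : (Nat.gcd p q : ℝ) ≤ D := by exact_mod_cast hgD
    have h1 : (0 : ℝ) < (M : ℝ) - (|b i| : ℤ) := by
      have : (|b i| : ℤ) < M := by omega
      have : ((|b i| : ℤ) : ℝ) < M := by exact_mod_cast this
      linarith
    have h2 : (M : ℝ) - (|b i| : ℤ) ≤ p * q := by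
      have h3 : (M : ℤ) - |b i| ≤ p * q := by
        have hq1 : (1 : ℤ) ≤ q := by omega
        calc (M : ℤ) - |b i| ≤ p := by rw [hp']; exact hi.1
          _ ≤ p * q := le_mul_of_one_le_right (by positivity) hq1
      exact_mod_cast h3
    rw [gcdKernel]
    exact div_le_div₀ (by positivity) (pow_le_pow_left₀ (by positivity) hgD' 2) h1 h2

section Plane

variable {ι : Type*} [Fintype ι] {c : ι → ℤ} {m : ι → ℕ} {b : ι → ℤ}

/-- The indices `i` whose linear form `m i * x + b i * y` has slope `l`. -/
def slopeClass (m : ι → ℕ) (b : ι → ℤ) (l : ℚ) : Finset ι :=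
  Finset.univ.filter fun i => (b i : ℚ) / m i = l

theorem mem_slopeClass_iff (hm : ∀ i, 0 < m i) (i j : ι) :
    i ∈ slopeClass m b ((b j : ℚ) / m j) ↔ b i * m j - m i * b j = 0 := by
  have hi : (m i : ℚ) ≠ 0 := by exact_mod_cast (hm i).ne'
  have hj : (m j : ℚ) ≠ 0 := by exact_mod_cast (hm j).ne'
  rw [slopeClass, Finset.mem_filter, div_eq_div_iff hi hj, sub_eq_zero]
  simp only [Finset.mem_univ, true_and]
  rw [mul_comm (m i : ℤ)]
  exact_mod_cast Iff.rfl

/-- If a sum of sawtooth functions of linear forms on the plane has values `±1/2`, then so have the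
sums over the parallel classes next to each jump. -/
theorem slopeClass_odd_or_half (hm : ∀ i, 0 < m i)
    (hF : ∀ x y : ℝ, ∑ i, (c i : ℝ) * saw (m i * x + b i * y) = 1 / 2 ∨
      ∑ i, (c i : ℝ) * saw (m i * x + b i * y) = -(1 / 2)) (i₀ : ι) (s : ℝ) :
    sawSum (slopeClass m b ((b i₀ : ℚ) / m i₀)) c m (-s)
        = -sawSum (slopeClass m b ((b i₀ : ℚ) / m i₀)) c m s ∨
      (sawSum (slopeClass m b ((b i₀ : ℚ) / m i₀)) c m (-s)
        = sawSum (slopeClass m b ((b i₀ : ℚ) / m i₀)) c m s ∧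
      (sawSum (slopeClass m b ((b i₀ : ℚ) / m i₀)) c m s = 1 / 2 ∨
        sawSum (slopeClass m b ((b i₀ : ℚ) / m i₀)) c m s = -(1 / 2))) := by
  classical
  set C := slopeClass m b ((b i₀ : ℚ) / m i₀) with hC
  set d : ι → ℤ := fun i => b i * m i₀ - m i * b i₀ with hd
  have hmem : ∀ i, i ∈ C ↔ d i = 0 := fun i => mem_slopeClass_iff hm i i₀
  -- On the line `(s - b i₀ * z, m i₀ * z)` the forms of the class `C` are constant in `z`. `R`
  -- collects the other forms, which really vary.
  set R : ℝ → ℝ := fun z => ∑ i ∈ Cᶜ, (c i : ℝ) * saw (m i * s + d i * z) with hR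
  have hF1 : ∀ z, ∑ i, (c i : ℝ) * saw (m i * (s - b i₀ * z) + b i * (m i₀ * z))
      = sawSum C c m s + R z := by
    intro z
    rw [← Finset.sum_add_sum_compl C, sawSum]
    congr 1
    · refine Finset.sum_congr rfl fun i hi => ?_
      have h0 : ((b i * m i₀ - m i * b i₀ : ℤ) : ℝ) = 0 := by exact_mod_cast (hmem i).1 hi
      push_cast at h0
      congr 2
      linear_combination z * h0
    · refine Finset.sum_congr rfl fun i _ => ?_
      congr 2
      rw [hd]; push_cast; ring
  have hF2 : ∀ z, (∀ i ∈ Cᶜ, Int.fract (m i * s + d i * z) ≠ 0) →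
      ∑ i, (c i : ℝ) * saw (m i * -(s - b i₀ * z) + b i * -(m i₀ * z))
      = sawSum C c m (-s) - R z := by
    intro z hz
    have hRn : -R z = ∑ i ∈ Cᶜ, -((c i : ℝ) * saw (m i * s + d i * z)) :=
      (Finset.sum_neg_distrib _).symm
    rw [← Finset.sum_add_sum_compl C, sawSum, sub_eq_add_neg (Finset.sum _ _) (R z), hRn]
    congr 1
    · refine Finset.sum_congr rfl fun i hi => ?_
      have h0 : ((b i * m i₀ - m i * b i₀ : ℤ) : ℝ) = 0 := by exact_mod_cast (hmem i).1 hi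
      push_cast at h0
      congr 2
      linear_combination (-z) * h0
    · refine Finset.sum_congr rfl fun i hi => ?_
      rw [← mul_neg (c i : ℝ), ← saw_neg_of_fract_ne_zero (hz i hi)]
      congr 2
      rw [hd]; push_cast; ring
  have hgen : ∀ᵐ z : ℝ, ∀ i ∈ Cᶜ, Int.fract (m i * s + d i * z) ≠ 0 := by
    rw [Filter.eventually_all_finset]
    intro i hi
    exact ae_fract_affine_ne_zero _ fun h => (Finset.mem_compl.1 hi) ((hmem i).2 h)
  by_cases hodd : sawSum C c m (-s) = -sawSum C c m s
  · exact Or.inl hodd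
  right
  -- The values at a point and its negative add up to the even part of the class sum, which is
  -- nonzero. So they are equal, and `R` is almost everywhere constant.
  have hRz : ∀ z, (∀ i ∈ Cᶜ, Int.fract (m i * s + d i * z) ≠ 0) →
      R z = (sawSum C c m (-s) - sawSum C c m s) / 2 ∧
        (sawSum C c m s + R z = 1 / 2 ∨ sawSum C c m s + R z = -(1 / 2)) := by
    intro z hz
    have h1 := hF (s - b i₀ * z) (m i₀ * z)
    have h2 := hF (-(s - b i₀ * z)) (-(m i₀ * z))
    rw [hF1] at h1
    rw [hF2 z hz] at h2
    refine ⟨?_, h1⟩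
    rcases h1 with h1 | h1 <;> rcases h2 with h2 | h2
    · linarith
    · exact (hodd (by linarith)).elim
    · exact (hodd (by linarith)).elim
    · linarith
  -- A nonconstant affine sawtooth has mean zero, so the constant value of `R` must be `0`.
  have hint0 : ∫ z in (0 : ℝ)..1, R z = 0 := by
    rw [hR, intervalIntegral.integral_finsetSum]
    · refine Finset.sum_eq_zero fun i hi => ?_
      rw [intervalIntegral.integral_const_mul,
        integral_saw_affine _ fun h => (Finset.mem_compl.1 hi) ((hmem i).2 h), mul_zero]
    · intro i _
      refine IntervalIntegrable.const_mul ?_ _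
      exact intervalIntegrable_of_abs_le
        (measurable_saw.comp ((measurable_const_mul _).const_add _)) (fun x => abs_saw_le _) _ _
  have hint1 : ∫ z in (0 : ℝ)..1, R z
      = ∫ z in (0 : ℝ)..1, (sawSum C c m (-s) - sawSum C c m s) / 2 := by
    apply intervalIntegral.integral_congr_ae
    filter_upwards [hgen] with z hz _
    exact (hRz z hz).1
  rw [hint0] at hint1
  simp only [intervalIntegral.integral_const, sub_zero, one_smul] at hint1
  obtain ⟨z, hz⟩ := hgen.exists
  obtain ⟨h1, h2⟩ := hRz z hz
  have h3 : R z = 0 := by rw [h1]; exact hint1.symm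
  rw [h3, add_zero] at h2
  exact ⟨by linarith, h2⟩

/-- Restriction to the lines `(M x, x)` gives one-variable sums with values `±1/2`, of form value
`3`. As `M → ∞`, the kernel between different slopes tends to `0`. -/
theorem sum_gcdForm_slopeClass (hm : ∀ i, 0 < m i)
    (hF : ∀ x y : ℝ, ∑ i, (c i : ℝ) * saw (m i * x + b i * y) = 1 / 2 ∨
      ∑ i, (c i : ℝ) * saw (m i * x + b i * y) = -(1 / 2)) :
    ∑ l ∈ Finset.univ.image (fun i => (b i : ℚ) / m i), gcdForm (slopeClass m b l) c m = 3 := by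
  classical
  have h1 : Filter.Tendsto (fun M : ℕ => gcdForm Finset.univ c fun i => (M * m i + b i).toNat)
      Filter.atTop (nhds (∑ i, ∑ j, (c i : ℝ) * c j *
        (if (b i : ℚ) / m i = (b j : ℚ) / m j then gcdKernel (m i) (m j) else 0))) :=
    tendsto_finsetSum _ fun i _ => tendsto_finsetSum _ fun j _ =>
      (tendsto_gcdKernel_translate hm i j).const_mul _
  have hpos : ∀ᶠ M : ℕ in Filter.atTop, ∀ i, 0 < (M : ℤ) * m i + b i := by
    rw [Filter.eventually_all]
    intro i
    filter_upwards [Filter.eventually_gt_atTop (|b i|).toNat] with M hM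
    have h1 : (M : ℤ) ≤ M * m i := le_mul_of_one_le_right (by positivity) (by exact_mod_cast hm i)
    have h2 := neg_abs_le (b i)
    omega
  have h2 : Filter.Tendsto (fun M : ℕ => gcdForm Finset.univ c fun i => (M * m i + b i).toNat)
      Filter.atTop (nhds 3) := by
    apply tendsto_const_nhds.congr'
    filter_upwards [hpos] with M hM
    refine (gcdForm_eq_three (fun i _ => by have := hM i; omega) fun x => ?_).symm
    have e : sawSum Finset.univ c (fun i => (M * m i + b i).toNat) x
        = ∑ i, (c i : ℝ) * saw (m i * (M * x) + b i * x) := by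
      refine Finset.sum_congr rfl fun i _ => ?_
      have : (((M * m i + b i).toNat : ℕ) : ℝ) = M * m i + b i := by
        exact_mod_cast Int.toNat_of_nonneg (hM i).le
      rw [this]
      congr 2
      ring
    rw [e]
    exact hF _ _
  rw [← tendsto_nhds_unique h1 h2]
  rw [← Finset.sum_fiberwise_of_maps_to
    (fun i _ => Finset.mem_image_of_mem _ (Finset.mem_univ i) :
      ∀ i ∈ Finset.univ, (b i : ℚ) / m i ∈ Finset.univ.image (fun i => (b i : ℚ) / m i))]
  refine Finset.sum_congr rfl fun l _ => ?_
  rw [gcdForm]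
  refine Finset.sum_congr rfl fun i hi => ?_
  have hil : (b i : ℚ) / m i = l := (Finset.mem_filter.1 hi).2
  rw [slopeClass, Finset.sum_filter]
  refine Finset.sum_congr rfl fun j _ => ?_
  rw [hil]
  simp only [eq_comm (a := l)]
  split_ifs <;> simp

/-- The weights of a planar sum of sawtooth functions with values `±1/2` split into three parts,
each of which is a single sawtooth function up to sign and a half-integral translation. -/
theorem exists_three_parts (hm : ∀ i, 0 < m i) (hinj : Function.Injective m) (hc : ∀ i, c i ≠ 0)
    (hF : ∀ x y : ℝ, ∑ i, (c i : ℝ) * saw (m i * x + b i * y) = 1 / 2 ∨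
      ∑ i, (c i : ℝ) * saw (m i * x + b i * y) = -(1 / 2))
    (hb : ∃ i j, (b i : ℚ) / m i ≠ (b j : ℚ) / m j) :
    ∃ (N : Fin 3 → ℕ) (ε : Fin 3 → ℤ) (w : Fin 3 → ℕ →₀ ℤ),
      weightFinsupp Finset.univ c m = w 0 + w 1 + w 2 ∧
      ∀ k, 0 < N k ∧ (ε k = 1 ∨ ε k = -1) ∧ (w k = Finsupp.single (N k) (ε k) ∨
        w k = Finsupp.single (2 * N k) (ε k) - Finsupp.single (N k) (ε k)) := by
  classical
  set κ := Finset.univ.image (fun i => (b i : ℚ) / m i) with hκ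
  have hsum := sum_gcdForm_slopeClass hm hF
  rw [← hκ] at hsum
  have hcls : ∀ l ∈ κ, gcdForm (slopeClass m b l) c m = 3 ∨
      (gcdForm (slopeClass m b l) c m = 1 ∧ ∃ (N : ℕ) (ε : ℤ), 0 < N ∧ (ε = 1 ∨ ε = -1) ∧
        (weightFinsupp (slopeClass m b l) c m = Finsupp.single N ε ∨
          weightFinsupp (slopeClass m b l) c m = Finsupp.single (2 * N) ε - Finsupp.single N ε)) := by
    intro l hl
    obtain ⟨i, -, rfl⟩ := Finset.mem_image.1 hl
    have hne : (slopeClass m b ((b i : ℚ) / m i)).Nonempty :=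
      ⟨i, Finset.mem_filter.2 ⟨Finset.mem_univ _, rfl⟩⟩
    rcases weightFinsupp_structure (fun i _ => hm i) hinj.injOn hne (fun i _ => hc i)
      (slopeClass_odd_or_half hm hF i) with h | ⟨N, ε, hN, hε, h⟩
    · exact Or.inl (gcdForm_eq_three (fun i _ => hm i) h)
    · exact Or.inr ⟨gcdForm_eq_one (fun i _ => hm i) hN hε h, N, ε, hN, hε, h⟩
  have hge : ∀ l ∈ κ, 1 ≤ gcdForm (slopeClass m b l) c m := by
    intro l hl
    rcases hcls l hl with h | ⟨h, -⟩
    · rw [h]; norm_num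
    · rw [h]
  obtain ⟨i, j, hij⟩ := hb
  -- A class of form value `3` would exhaust the total, but there is a second class, of value at
  -- least `1`.
  have hone : ∀ l ∈ κ, gcdForm (slopeClass m b l) c m ≠ 3 := by
    intro l hl h3
    obtain ⟨l', hl', hne⟩ : ∃ l' ∈ κ, l' ≠ l := by
      by_cases h : (b i : ℚ) / m i = l
      · exact ⟨_, Finset.mem_image_of_mem _ (Finset.mem_univ j), fun h' => hij (h.trans h'.symm)⟩
      · exact ⟨_, Finset.mem_image_of_mem _ (Finset.mem_univ i), h⟩
    have h4 := Finset.add_sum_erase κ (fun l => gcdForm (slopeClass m b l) c m) hl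
    have h5 := Finset.single_le_sum (f := fun l => gcdForm (slopeClass m b l) c m)
      (fun k hk => zero_le_one.trans (hge k (Finset.mem_of_mem_erase hk)))
      (Finset.mem_erase.2 ⟨hne, hl'⟩)
    have h6 := hge l' hl'
    linarith
  have hall : ∀ l ∈ κ, gcdForm (slopeClass m b l) c m = 1 :=
    fun l hl => ((hcls l hl).resolve_left (hone l hl)).1
  rw [Finset.sum_congr rfl hall, Finset.sum_const, nsmul_eq_mul, mul_one] at hsum
  have hcard : κ.card = 3 := by exact_mod_cast hsum
  obtain ⟨x, y, z, hxy, hxz, hyz, hκe⟩ := Finset.card_eq_three.1 hcard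
  have hxm : x ∈ κ := by rw [hκe]; simp
  have hym : y ∈ κ := by rw [hκe]; simp
  have hzm : z ∈ κ := by rw [hκe]; simp
  obtain ⟨-, N₀, ε₀, h₀⟩ := (hcls x hxm).resolve_left (hone x hxm)
  obtain ⟨-, N₁, ε₁, h₁⟩ := (hcls y hym).resolve_left (hone y hym)
  obtain ⟨-, N₂, ε₂, h₂⟩ := (hcls z hzm).resolve_left (hone z hzm)
  refine ⟨![N₀, N₁, N₂], ![ε₀, ε₁, ε₂], ![weightFinsupp (slopeClass m b x) c m,
    weightFinsupp (slopeClass m b y) c m, weightFinsupp (slopeClass m b z) c m], ?_, ?_⟩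
  · rw [hκ] at hκe
    rw [weightFinsupp, ← Finset.sum_fiberwise_of_maps_to
      (fun i _ => Finset.mem_image_of_mem _ (Finset.mem_univ i) : ∀ i ∈ Finset.univ, _ ∈ κ),
      hκe, Finset.sum_insert (by simp [hxy, hxz]), Finset.sum_insert (by simp [hyz]),
      Finset.sum_singleton, ← add_assoc]
    rfl
  · intro k
    fin_cases k
    exacts [h₀, h₁, h₂]

end Plane

/-! ### Weights of multisets and recognition of the families -/

/-- The multiplicity function of a multiset of natural numbers, with integer values. -/
noncomputable def multisetWeight (A : Multiset ℕ) : ℕ →₀ ℤ :=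
  (A.map fun a => Finsupp.single a (1 : ℤ)).sum

theorem multisetWeight_apply (A : Multiset ℕ) (k : ℕ) : multisetWeight A k = A.count k := by
  induction A using Multiset.induction_on with
  | empty => simp [multisetWeight]
  | cons a A ih =>
    rw [multisetWeight, Multiset.map_cons, Multiset.sum_cons, Finsupp.add_apply,
      ← multisetWeight, ih, Multiset.count_cons, Finsupp.single_apply]
    simp only [eq_comm (a := a)]
    split_ifs <;> push_cast <;> ring

theorem map_multisetWeight (f : (ℕ →₀ ℤ) →+ ℤ) (A : Multiset ℕ) :
    f (multisetWeight A) = (A.map fun a => f (Finsupp.single a 1)).sum := by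
  rw [multisetWeight, map_multiset_sum, Multiset.map_map]
  rfl

theorem eq_of_multisetWeight_sub_eq {A B A' B' : Multiset ℕ} (h : ∀ a ∈ A, a ∉ B)
    (h' : ∀ a ∈ A', a ∉ B')
    (hw : multisetWeight A - multisetWeight B = multisetWeight A' - multisetWeight B') :
    A = A' ∧ B = B' := by
  have key : ∀ k, A.count k = A'.count k ∧ B.count k = B'.count k := by
    intro k
    have h1 := DFunLike.congr_fun hw k
    simp only [Finsupp.sub_apply, multisetWeight_apply] at h1
    have h2 : A.count k = 0 ∨ B.count k = 0 := by
      by_cases hk : k ∈ A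
      · exact Or.inr (Multiset.count_eq_zero.2 (h k hk))
      · exact Or.inl (Multiset.count_eq_zero.2 hk)
    have h3 : A'.count k = 0 ∨ B'.count k = 0 := by
      by_cases hk : k ∈ A'
      · exact Or.inr (Multiset.count_eq_zero.2 (h' k hk))
      · exact Or.inl (Multiset.count_eq_zero.2 hk)
    omega
  exact ⟨Multiset.ext.2 fun k => (key k).1, Multiset.ext.2 fun k => (key k).2⟩

/-- Disjointness excludes cancellation, so every entry of `A` or `B` has nonzero weight and is
divisible by `g`. -/
theorem eq_one_of_dvd_support {A B : Multiset ℕ} (h : ∀ a ∈ A, a ∉ B) (hg : (A + B).gcd = 1)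
    {g : ℕ} (hw : ∀ k, ¬ g ∣ k → (multisetWeight A - multisetWeight B) k = 0) : g = 1 := by
  refine Nat.dvd_one.1 (hg ▸ Multiset.dvd_gcd.2 fun k hk => ?_)
  by_contra hgk
  have h0 := hw k hgk
  simp only [Finsupp.sub_apply, multisetWeight_apply] at h0
  by_cases hA : k ∈ A
  · have h1 := Multiset.count_eq_zero.2 (h k hA)
    have h2 := Multiset.count_pos.2 hA
    omega
  · have hB : k ∈ B := (Multiset.mem_add.1 hk).resolve_left hA
    have h1 := Multiset.count_eq_zero.2 hA
    have h2 := Multiset.count_pos.2 hB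
    omega

section Families

variable {A B : Multiset ℕ}

theorem mem_firstFamily_of_weight (h : ∀ a ∈ A, a ∉ B) (hg : (A + B).gcd = 1) {a b : ℕ}
    (ha : 0 < a) (hb : 0 < b) (hw : multisetWeight A - multisetWeight B
      = Finsupp.single (a + b) 1 - Finsupp.single a 1 - Finsupp.single b 1) :
    (A, B) ∈ firstFamily := by
  have hab : Nat.Coprime a b := by
    apply eq_one_of_dvd_support h hg
    intro k hk
    have h1 : a ≠ k := fun h => hk (h ▸ Nat.gcd_dvd_left a b)
    have h2 : b ≠ k := fun h => hk (h ▸ Nat.gcd_dvd_right a b)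
    have h3 : a + b ≠ k := fun h => hk (h ▸ dvd_add (Nat.gcd_dvd_left a b) (Nat.gcd_dvd_right a b))
    simp [hw, h1, h2, h3]
  obtain ⟨rfl, rfl⟩ := eq_of_multisetWeight_sub_eq (A' := {a + b}) (B' := {a, b}) h
    (by simp; omega) (by rw [hw]; simp [multisetWeight]; abel)
  exact ⟨a, b, ha, hb, hab, rfl⟩

theorem mem_families_of_secondFamily_weight (h : ∀ a ∈ A, a ∉ B) (hg : (A + B).gcd = 1) {a b : ℕ}
    (ha : 0 < a) (hb : 0 < b) (hw : multisetWeight A - multisetWeight B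
      = Finsupp.single (2 * a) 1 + Finsupp.single (2 * b) 1 - Finsupp.single a 1
        - Finsupp.single b 1 - Finsupp.single (a + b) 1) :
    (A, B) ∈ firstFamily ∪ secondFamily ∪ thirdFamily := by
  have hab : Nat.Coprime a b := by
    apply eq_one_of_dvd_support h hg
    intro k hk
    have h1 : a ≠ k := fun h => hk (h ▸ Nat.gcd_dvd_left a b)
    have h2 : b ≠ k := fun h => hk (h ▸ Nat.gcd_dvd_right a b)
    have h3 : a + b ≠ k := fun h => hk (h ▸ dvd_add (Nat.gcd_dvd_left a b) (Nat.gcd_dvd_right a b))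
    have h4 : 2 * a ≠ k := fun h => hk (h ▸ (Nat.gcd_dvd_left a b).mul_left 2)
    have h5 : 2 * b ≠ k := fun h => hk (h ▸ (Nat.gcd_dvd_right a b).mul_left 2)
    simp [hw, h1, h2, h3, h4, h5]
  -- The degenerate pairs cancel to members of the first family: `{2}` over `{1, 1}`, and `{4}` over
  -- `{1, 3}`.
  by_cases h11 : (a, b) = (1, 1)
  · obtain ⟨rfl, rfl⟩ := Prod.mk.inj h11
    refine Or.inl (Or.inl (mem_firstFamily_of_weight h hg (a := 1) (b := 1) one_pos one_pos ?_))
    rw [hw]; norm_num; abel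
  by_cases h12 : (a, b) = (1, 2)
  · obtain ⟨rfl, rfl⟩ := Prod.mk.inj h12
    refine Or.inl (Or.inl (mem_firstFamily_of_weight h hg (a := 1) (b := 3) one_pos (by simp) ?_))
    rw [hw]; norm_num; abel
  by_cases h21 : (a, b) = (2, 1)
  · obtain ⟨rfl, rfl⟩ := Prod.mk.inj h21
    refine Or.inl (Or.inl (mem_firstFamily_of_weight h hg (a := 1) (b := 3) one_pos (by simp) ?_))
    rw [hw]; norm_num
  have h1 : b = 2 * a → a = 1 := fun h => by
    rwa [h, Nat.Coprime, Nat.gcd_eq_left (Dvd.intro_left 2 rfl)] at hab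
  have h2 : a = 2 * b → b = 1 := fun h => by
    rwa [h, Nat.Coprime, Nat.gcd_eq_right (Dvd.intro_left 2 rfl)] at hab
  have h3 : a = b → a = 1 := fun h => by
    rwa [← h, Nat.Coprime, Nat.gcd_self] at hab
  simp only [Prod.mk.injEq] at h11 h12 h21
  obtain ⟨rfl, rfl⟩ := eq_of_multisetWeight_sub_eq (A' := {2 * a, 2 * b}) (B' := {a, b, a + b}) h
    (by simp; omega) (by rw [hw]; simp [multisetWeight]; abel)
  exact Or.inl (Or.inr ⟨a, b, ha, hb, hab, by simpa using h11, by simpa using h12,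
    by simpa using h21, rfl⟩)

theorem mem_thirdFamily_of_weight (h : ∀ a ∈ A, a ∉ B) (hg : (A + B).gcd = 1) {a b : ℕ}
    (hb : 0 < b) (hba : b < a) (hw : multisetWeight A - multisetWeight B
      = Finsupp.single (2 * a) 1 + Finsupp.single b 1 - Finsupp.single a 1
        - Finsupp.single (2 * b) 1 - Finsupp.single (a - b) 1) :
    (A, B) ∈ thirdFamily := by
  have hab : Nat.Coprime a b := by
    apply eq_one_of_dvd_support h hg
    intro k hk
    have h1 : a ≠ k := fun h => hk (h ▸ Nat.gcd_dvd_left a b)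
    have h2 : b ≠ k := fun h => hk (h ▸ Nat.gcd_dvd_right a b)
    have h3 : a - b ≠ k :=
      fun h => hk (h ▸ Nat.dvd_sub (Nat.gcd_dvd_left a b) (Nat.gcd_dvd_right a b))
    have h4 : 2 * a ≠ k := fun h => hk (h ▸ (Nat.gcd_dvd_left a b).mul_left 2)
    have h5 : 2 * b ≠ k := fun h => hk (h ▸ (Nat.gcd_dvd_right a b).mul_left 2)
    simp [hw, h1, h2, h3, h4, h5]
  -- Here cancellation leaves `{4}` over `{2, 2}`, which is not primitive.
  have h21 : ¬(a = 2 ∧ b = 1) := by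
    rintro ⟨rfl, rfl⟩
    have := eq_one_of_dvd_support h hg (g := 2) fun k hk => by
      have h1 : 2 ≠ k := fun h => hk (h ▸ dvd_rfl)
      have h2 : 4 ≠ k := fun h => hk (h ▸ by norm_num)
      rw [hw]
      simp [h1, h2]
    omega
  have h2 : a = 2 * b → b = 1 := fun h => by
    rwa [h, Nat.Coprime, Nat.gcd_eq_right (Dvd.intro_left 2 rfl)] at hab
  obtain ⟨rfl, rfl⟩ := eq_of_multisetWeight_sub_eq (A' := {2 * a, b}) (B' := {a, 2 * b, a - b}) h
    (by simp; omega) (by rw [hw]; simp [multisetWeight]; abel)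
  exact ⟨a, b, hb, hba, hab, by simpa using h21, rfl⟩

/-- A part `[N]` has total weight `ε` and a part `[2N] - [N]` has total weight `0`; both have moment
`ε * N`. The total is `-1` and the moment is `0`. By parity there are three simple parts, giving the
first family, or one, of sign `-1`. In the latter case the two differences have both signs `+1`
(second family) or opposite signs (third family). -/
theorem mem_families_of_parts (h : ∀ a ∈ A, a ∉ B) (hg : (A + B).gcd = 1)
    (hsum : A.sum = B.sum) (hcard : B.card = A.card + 1)
    {N₀ N₁ N₂ : ℕ} {ε₀ ε₁ ε₂ : ℤ} {w₀ w₁ w₂ : ℕ →₀ ℤ}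
    (hN₀ : 0 < N₀) (hN₁ : 0 < N₁) (hN₂ : 0 < N₂)
    (hε₀ : ε₀ = 1 ∨ ε₀ = -1) (hε₁ : ε₁ = 1 ∨ ε₁ = -1) (hε₂ : ε₂ = 1 ∨ ε₂ = -1)
    (hw₀ : w₀ = Finsupp.single N₀ ε₀ ∨ w₀ = Finsupp.single (2 * N₀) ε₀ - Finsupp.single N₀ ε₀)
    (hw₁ : w₁ = Finsupp.single N₁ ε₁ ∨ w₁ = Finsupp.single (2 * N₁) ε₁ - Finsupp.single N₁ ε₁)
    (hw₂ : w₂ = Finsupp.single N₂ ε₂ ∨ w₂ = Finsupp.single (2 * N₂) ε₂ - Finsupp.single N₂ ε₂)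
    (hw : multisetWeight A - multisetWeight B = w₀ + w₁ + w₂) :
    (A, B) ∈ firstFamily ∪ secondFamily ∪ thirdFamily := by
  let total : (ℕ →₀ ℤ) →+ ℤ := Finsupp.liftAddHom fun _ => AddMonoidHom.id ℤ
  let moment : (ℕ →₀ ℤ) →+ ℤ := Finsupp.liftAddHom fun k => AddMonoidHom.mulRight (k : ℤ)
  have htot : ∀ k a, total (Finsupp.single k a) = a := fun k a => by simp [total]
  have hmom : ∀ k a, moment (Finsupp.single k a) = a * k := fun k a => by simp [moment]
  have htA : ∀ A : Multiset ℕ, total (multisetWeight A) = A.card := fun A => by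
    rw [map_multisetWeight]; simp [htot]
  have hmA : ∀ A : Multiset ℕ, moment (multisetWeight A) = A.sum := fun A => by
    rw [map_multisetWeight]; simp [hmom]
  have e1 := congrArg total hw
  have e2 := congrArg moment hw
  rw [map_sub, htA, htA, hcard, map_add, map_add] at e1
  rw [map_sub, hmA, hmA, hsum, map_add, map_add] at e2
  have fam1 : ∀ a b : ℕ, 0 < a → 0 < b → multisetWeight A - multisetWeight B
      = Finsupp.single (a + b) 1 + Finsupp.single a (-1) + Finsupp.single b (-1) →
      (A, B) ∈ firstFamily ∪ secondFamily ∪ thirdFamily := fun a b ha hb hw =>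
    Or.inl (Or.inl (mem_firstFamily_of_weight h hg ha hb
      (by rw [hw, Finsupp.single_neg, Finsupp.single_neg]; abel)))
  have fam2 : ∀ a b : ℕ, 0 < a → 0 < b → multisetWeight A - multisetWeight B
      = Finsupp.single (a + b) (-1) + (Finsupp.single (2 * a) 1 - Finsupp.single a 1)
        + (Finsupp.single (2 * b) 1 - Finsupp.single b 1) →
      (A, B) ∈ firstFamily ∪ secondFamily ∪ thirdFamily := fun a b ha hb hw =>
    mem_families_of_secondFamily_weight h hg ha hb
      (by rw [hw, Finsupp.single_neg]; abel)
  have fam3 : ∀ d b : ℕ, 0 < d → 0 < b → multisetWeight A - multisetWeight B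
      = Finsupp.single d (-1) + (Finsupp.single (2 * (d + b)) 1 - Finsupp.single (d + b) 1)
        + (Finsupp.single (2 * b) (-1) - Finsupp.single b (-1)) →
      (A, B) ∈ firstFamily ∪ secondFamily ∪ thirdFamily := fun d b hd hb hw =>
    Or.inr (mem_thirdFamily_of_weight h hg hb (by omega : b < d + b)
      (by rw [hw, Nat.add_sub_cancel, Finsupp.single_neg, Finsupp.single_neg,
            Finsupp.single_neg]; abel))
  have T : ∀ a b c : ℕ →₀ ℤ, a + b + c = b + a + c ∧ a + b + c = c + a + b ∧
      a + b + c = a + c + b ∧ a + b + c = b + c + a ∧ a + b + c = c + b + a :=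
    fun a b c => ⟨by abel, by abel, by abel, by abel, by abel⟩
  obtain ⟨t1, t2, t3, t4, t5⟩ := T w₀ w₁ w₂
  rcases hw₀ with rfl | rfl <;> rcases hw₁ with rfl | rfl <;> rcases hw₂ with rfl | rfl <;>
  simp only [map_sub, htot, hmom] at e1 e2 <;>
  rcases hε₀ with rfl | rfl <;> rcases hε₁ with rfl | rfl <;> rcases hε₂ with rfl | rfl <;>
  first
  | (exfalso; push_cast at e1 e2; omega)
  | (obtain rfl : N₀ = N₁ + N₂ := by push_cast at e2; omega
     first
     | exact fam1 N₁ N₂ hN₁ hN₂ hw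
     | exact fam2 N₁ N₂ hN₁ hN₂ hw
     | exact fam3 N₁ N₂ hN₁ hN₂ (hw.trans t1)
     | (rw [add_comm N₁ N₂] at *; exact fam3 N₂ N₁ hN₂ hN₁ (hw.trans t2)))
  | (obtain rfl : N₁ = N₀ + N₂ := by push_cast at e2; omega
     first
     | exact fam1 N₀ N₂ hN₀ hN₂ (hw.trans t1)
     | exact fam2 N₀ N₂ hN₀ hN₂ (hw.trans t1)
     | exact fam3 N₀ N₂ hN₀ hN₂ hw
     | (rw [add_comm N₀ N₂] at *; exact fam3 N₂ N₀ hN₂ hN₀ (hw.trans t5)))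
  | (obtain rfl : N₂ = N₀ + N₁ := by push_cast at e2; omega
     first
     | exact fam1 N₀ N₁ hN₀ hN₁ (hw.trans t2)
     | exact fam2 N₀ N₁ hN₀ hN₁ (hw.trans t2)
     | exact fam3 N₀ N₁ hN₀ hN₁ (hw.trans t3)
     | (rw [add_comm N₀ N₁] at *; exact fam3 N₁ N₀ hN₁ hN₀ (hw.trans t4)))

end Families

/-! ### Lines in tori -/

/-- Translation by `1 / (2 n)` changes the sign of the character. -/
theorem integral_fourier_eq_zero {n : ℤ} (hn : n ≠ 0) :
    ∫ x : UnitAddCircle, fourier n x = 0 := by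
  have h := MeasureTheory.integral_add_right_eq_self (μ := MeasureTheory.volume)
    (fun x : UnitAddCircle => fourier n x) ((1 / 2 / n : ℝ) : UnitAddCircle)
  simp only [fourier_add_half_inv_index hn one_pos] at h
  rw [MeasureTheory.integral_neg] at h
  exact self_eq_neg.1 h.symm

theorem integral_mFourier_eq_zero {r : ℕ} {n : Fin r → ℤ} (hn : n ≠ 0) :
    ∫ t : UnitAddTorus (Fin r), UnitAddTorus.mFourier n t = 0 := by
  simp only [UnitAddTorus.mFourier, ContinuousMap.coe_mk]
  rw [MeasureTheory.integral_fintype_prod_volume_eq_prod]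
  obtain ⟨i, hi⟩ := Function.ne_iff.1 hn
  exact Finset.prod_eq_zero (Finset.mem_univ i) (integral_fourier_eq_zero hi)

theorem mFourier_line {r : ℕ} (n A : Fin r → ℤ) (x : ℝ) :
    UnitAddTorus.mFourier n (fun j => ((A j * x : ℝ) : UnitAddCircle))
      = Complex.exp (2 * Real.pi * Complex.I * (∑ j, n j * A j : ℤ) * x) := by
  simp only [UnitAddTorus.mFourier, ContinuousMap.coe_mk, fourier_coe_apply]
  rw [← Complex.exp_sum]
  congr 1
  push_cast
  rw [Finset.mul_sum, Finset.sum_mul]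
  refine Finset.sum_congr rfl fun j _ => ?_
  ring

theorem integral_mFourier_line {r : ℕ} {n A : Fin r → ℤ} (h : ∑ j, n j * A j ≠ 0) :
    ∫ x in (0 : ℝ)..1, UnitAddTorus.mFourier n (fun j => ((A j * x : ℝ) : UnitAddCircle)) = 0 := by
  simp only [mFourier_line]
  have hc : 2 * (Real.pi : ℂ) * Complex.I * ((∑ j, n j * A j : ℤ) : ℂ) ≠ 0 :=
    mul_ne_zero Complex.two_pi_I_ne_zero (by exact_mod_cast h)
  rw [integral_exp_mul_complex hc]
  have : Complex.exp (2 * (Real.pi : ℂ) * Complex.I * ((∑ j, n j * A j : ℤ) : ℂ) * (1 : ℝ)) = 1 := by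
    rw [Complex.exp_eq_one_iff]
    exact ⟨∑ j, n j * A j, by push_cast; ring⟩
  rw [this]
  simp

/-- A line through the origin of a torus meets a given nonempty open set, unless its direction is
orthogonal to one of finitely many nonzero integral vectors. -/
theorem exists_characters_of_isOpen {r : ℕ} {V : Set (Fin r → ℝ)} (hV : IsOpen V)
    (hne : V.Nonempty) : ∃ S : Finset (Fin r → ℤ), (∀ n ∈ S, n ≠ 0) ∧
      ∀ A : Fin r → ℤ, (∀ n ∈ S, ∑ j, n j * A j ≠ 0) →
        ∃ x : ℝ, ∃ v ∈ V, ∀ j, ∃ k : ℤ, (A j : ℝ) * x = v j + k := by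
  classical
  have : MeasureTheory.IsProbabilityMeasure (MeasureTheory.volume : MeasureTheory.Measure
    UnitAddCircle) := ⟨UnitAddCircle.measure_univ⟩
  set q : (Fin r → ℝ) → UnitAddTorus (Fin r) := fun v j => (v j : UnitAddCircle) with hq
  have hqo : IsOpenMap q :=
    IsOpenMap.piMap (fun _ => QuotientAddGroup.isOpenMap_coe) (by simp)
  obtain ⟨v₀, hv₀⟩ := hne
  obtain ⟨ε, hε, hball⟩ := Metric.isOpen_iff.1 (hqo V hV) (q v₀) (Set.mem_image_of_mem _ hv₀)
  set g : UnitAddTorus (Fin r) → ℝ := fun t => max 0 (ε - dist t (q v₀)) with hg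
  have hgc : Continuous g := by fun_prop
  have hg0 : ∀ t, 0 ≤ g t := fun t => le_max_left _ _
  have hgpos : 0 < ∫ t, g t :=
    hgc.integral_pos_of_hasCompactSupport_nonneg_nonzero
      (HasCompactSupport.of_compactSpace g) hg0 (x := q v₀) (by simp [hg, hε.ne', hε.le])
  -- The bump `g` is approximated by a trigonometric polynomial `P` within `δ`. Two errors of size
  -- `δ` cannot account for the integral `3 * δ`.
  set δ := (∫ t, g t) / 3 with hδ
  have hδ0 : 0 < δ := by positivity
  set G : C(UnitAddTorus (Fin r), ℂ) := ⟨fun t => (g t : ℂ), by fun_prop⟩ with hG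
  have hGmem : G ∈ closure ((Submodule.span ℂ (Set.range (UnitAddTorus.mFourier (d := Fin r))) :
      Submodule ℂ C(UnitAddTorus (Fin r), ℂ)) : Set C(UnitAddTorus (Fin r), ℂ)) := by
    rw [← Submodule.topologicalClosure_coe, UnitAddTorus.span_mFourier_closure_eq_top]
    trivial
  obtain ⟨P, hP, hPG⟩ := Metric.mem_closure_iff.1 hGmem δ hδ0
  obtain ⟨p, hp⟩ := Finsupp.mem_span_range_iff_exists_finsupp.1 hP
  have hPt : ∀ t, P t = ∑ n ∈ insert 0 p.support, p n * UnitAddTorus.mFourier n t := by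
    intro t
    rw [← hp, Finsupp.sum_of_support_subset p (Finset.subset_insert 0 _) _ (by simp)]
    simp [ContinuousMap.coe_sum]
  have hclose : ∀ t, ‖(g t : ℂ) - P t‖ ≤ δ := by
    intro t
    have := (ContinuousMap.dist_apply_le_dist (f := G) (g := P) t).trans hPG.le
    rwa [dist_eq_norm] at this
  have hint : ∫ t, P t = p 0 := by
    simp only [hPt]
    rw [MeasureTheory.integral_finsetSum]
    · rw [Finset.sum_eq_single_of_mem 0 (Finset.mem_insert_self _ _)]
      · rw [MeasureTheory.integral_const_mul, UnitAddTorus.mFourier_zero]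
        simp
      · intro n _ hn
        rw [MeasureTheory.integral_const_mul, integral_mFourier_eq_zero hn, mul_zero]
    · intro n _
      exact (continuous_const.mul (UnitAddTorus.mFourier n).continuous).integrable_of_hasCompactSupport
        (HasCompactSupport.of_compactSpace _)
  have hp0 : ‖((∫ t, g t : ℝ) : ℂ) - p 0‖ ≤ δ := by
    rw [← hint, ← integral_complex_ofReal, ← MeasureTheory.integral_sub]
    · refine (MeasureTheory.norm_integral_le_of_norm_le_const
        (Filter.Eventually.of_forall hclose)).trans ?_
      simp
    · exact (Complex.continuous_ofReal.comp hgc).integrable_of_hasCompactSupport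
        (HasCompactSupport.of_compactSpace _)
    · exact P.continuous.integrable_of_hasCompactSupport (HasCompactSupport.of_compactSpace _)
  refine ⟨p.support.erase 0, fun n hn => Finset.ne_of_mem_erase hn, fun A hA => ?_⟩
  have hx : ∃ x : ℝ, q (fun j => A j * x) ∈ Metric.ball (q v₀) ε := by
    by_contra! hno
    have hgz : ∀ x : ℝ, g (q fun j => A j * x) = 0 := by
      intro x
      have := hno x
      rw [Metric.mem_ball, not_lt] at this
      exact max_eq_left (by linarith)
    -- No nonzero frequency of `P` is orthogonal to `A`, so the mean of `P` on the line is its mean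
    -- `p 0` on the torus. But `g` vanishes on the line, which makes this mean at most `δ`.
    have hline : ∫ x in (0 : ℝ)..1, P (q fun j => A j * x) = p 0 := by
      simp only [hPt]
      rw [intervalIntegral.integral_finsetSum]
      · rw [Finset.sum_eq_single_of_mem 0 (Finset.mem_insert_self _ _)]
        · rw [intervalIntegral.integral_const_mul, UnitAddTorus.mFourier_zero]
          simp
        · intro n hn hn0
          have hnS : n ∈ p.support.erase 0 :=
            Finset.mem_erase.2 ⟨hn0, (Finset.mem_insert.1 hn).resolve_left hn0⟩
          rw [intervalIntegral.integral_const_mul, integral_mFourier_line (hA n hnS), mul_zero]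
      · intro n _
        simp only [hq, mFourier_line]
        apply Continuous.intervalIntegrable
        fun_prop
    have hle : ‖∫ x in (0 : ℝ)..1, P (q fun j => A j * x)‖ ≤ δ * |(1 : ℝ) - 0| := by
      apply intervalIntegral.norm_integral_le_of_norm_le_const
      intro x _
      have := hclose (q fun j => A j * x)
      rwa [hgz x, Complex.ofReal_zero, zero_sub, norm_neg] at this
    rw [hline] at hle
    have h1 : ‖((∫ t, g t : ℝ) : ℂ)‖ ≤ δ + δ := by
      calc ‖((∫ t, g t : ℝ) : ℂ)‖ = ‖(((∫ t, g t : ℝ) : ℂ) - p 0) + p 0‖ := by rw [sub_add_cancel]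
        _ ≤ _ := (norm_add_le _ _).trans (add_le_add hp0 (by simpa using hle))
    rw [Complex.norm_real, Real.norm_of_nonneg hgpos.le] at h1
    linarith
  obtain ⟨x, hx⟩ := hx
  obtain ⟨v, hv, hvx⟩ := hball hx
  refine ⟨x, v, hv, fun j => ?_⟩
  have h1 : ((v j : ℝ) : UnitAddCircle) = ((A j * x : ℝ) : UnitAddCircle) := congrFun hvx j
  obtain ⟨k, hk⟩ := (QuotientAddGroup.eq_iff_sub_mem.1 h1.symm)
  exact ⟨k, by simp at hk; linarith⟩

/-! ### Landau's criterion -/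

/-- Floors are right-continuous. Moving slightly to the right preserves them and leaves all jump
points, which reduces statements at every point to generic ones. -/
theorem eventually_floor_affine_eq {a : ℝ} (ha : 0 < a) (β x : ℝ) :
    ∀ᶠ y in nhdsWithin x (Set.Ioi x), ⌊a * y + β⌋ = ⌊a * x + β⌋ ∧ Int.fract (a * y + β) ≠ 0 := by
  have hx : x < (⌊a * x + β⌋ + 1 - β) / a := by
    rw [lt_div_iff₀ ha]
    linarith [Int.lt_floor_add_one (a * x + β)]
  filter_upwards [Ioo_mem_nhdsGT hx] with y hy
  have h1 : a * x < a * y := mul_lt_mul_of_pos_left hy.1 ha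
  have h2 : a * y < ⌊a * x + β⌋ + 1 - β := by
    have := hy.2
    rw [lt_div_iff₀ ha] at this
    linarith
  have h3 := Int.floor_le (a * x + β)
  have hf : ⌊a * y + β⌋ = ⌊a * x + β⌋ := by
    rw [Int.floor_eq_iff]; constructor <;> linarith
  refine ⟨hf, fun h => ?_⟩
  have := Int.self_sub_floor (a * y + β)
  rw [hf, h] at this
  linarith

theorem sawFinsupp_multisetWeight (A : Multiset ℕ) (x : ℝ) :
    sawFinsupp (multisetWeight A) x = (A.map fun a : ℕ => saw (a * x)).sum := by
  induction A using Multiset.induction_on with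
  | empty => simp [multisetWeight, sawFinsupp]
  | cons a A ih =>
    rw [multisetWeight, Multiset.map_cons, Multiset.sum_cons, sawFinsupp_add, ← multisetWeight, ih,
      sawFinsupp_single, Multiset.map_cons, Multiset.sum_cons]
    simp

theorem sawFinsupp_multisetWeight_eq_floor (A : Multiset ℕ) (x : ℝ) :
    sawFinsupp (multisetWeight A) x
      = A.card / 2 - A.sum * x + ((A.map fun a : ℕ => ⌊(a : ℝ) * x⌋).sum : ℤ) := by
  rw [sawFinsupp_multisetWeight]
  induction A using Multiset.induction_on with
  | empty => simp
  | cons a A ih =>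
    rw [Multiset.map_cons, Multiset.sum_cons, ih, saw_eq]
    simp only [Multiset.card_cons, Multiset.sum_cons, Multiset.map_cons]
    push_cast
    ring

theorem padicValNat_multiset_prod (p : ℕ) [Fact p.Prime] (A : Multiset ℕ) (f : ℕ → ℕ)
    (hf : ∀ a, f a ≠ 0) :
    padicValNat p (A.map f).prod = (A.map fun a => padicValNat p (f a)).sum := by
  induction A using Multiset.induction_on with
  | empty => simp
  | cons a A ih =>
    have : (A.map f).prod ≠ 0 := by
      rw [Ne, Multiset.prod_eq_zero_iff, Multiset.mem_map]
      rintro ⟨b, -, hb⟩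
      exact hf b hb
    rw [Multiset.map_cons, Multiset.prod_cons, padicValNat.mul (hf a) this, ih, Multiset.map_cons,
      Multiset.sum_cons]

theorem factorialRatio_eq_natCast_iff (A B : Multiset ℕ) (n : ℕ) :
    (∃ m : ℕ, factorialRatio A B n = m) ↔
      (B.map fun b => (b * n)!).prod ∣ (A.map fun a => (a * n)!).prod := by
  have hcast : ∀ A : Multiset ℕ, (A.map fun a => (((a * n)! : ℕ) : ℚ)).prod
      = (((A.map fun a => (a * n)!).prod : ℕ) : ℚ) := by
    intro A
    rw [Nat.cast_multiset_prod, Multiset.map_map]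
    rfl
  have hB : ((B.map fun b => (b * n)!).prod : ℕ) ≠ 0 := by
    rw [Ne, Multiset.prod_eq_zero_iff, Multiset.mem_map]
    rintro ⟨b, -, hb⟩
    exact Nat.factorial_ne_zero _ hb
  have hB' : (((B.map fun b => (b * n)!).prod : ℕ) : ℚ) ≠ 0 := by exact_mod_cast hB
  rw [factorialRatio, hcast, hcast]
  constructor
  · rintro ⟨m, hm⟩
    rw [div_eq_iff hB'] at hm
    exact ⟨m, by rw [mul_comm]; exact_mod_cast hm⟩
  · rintro ⟨m, hm⟩
    refine ⟨m, ?_⟩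
    rw [hm, Nat.cast_mul, mul_div_cancel_left₀ _ hB']

/-- Landau's criterion, sufficiency. -/
theorem integral_of_sum_div_le {A B : Multiset ℕ}
    (h : ∀ n q : ℕ, 0 < q → (B.map fun b => b * n / q).sum ≤ (A.map fun a => a * n / q).sum)
    (n : ℕ) : ∃ m : ℕ, factorialRatio A B n = m := by
  rw [factorialRatio_eq_natCast_iff]
  have hne : ∀ A : Multiset ℕ, (A.map fun b => (b * n)!).prod ≠ 0 := by
    intro A
    rw [Ne, Multiset.prod_eq_zero_iff, Multiset.mem_map]
    rintro ⟨b, -, hb⟩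
    exact Nat.factorial_ne_zero _ hb
  rw [← Nat.factorization_prime_le_iff_dvd (hne B) (hne A)]
  intro p hp
  have : Fact p.Prime := ⟨hp⟩
  -- Legendre's formula with a single cutoff for the exponents, large enough for all factors.
  have hval : ∀ C : Multiset ℕ, C ≤ A + B → (C.map fun b => (b * n)!).prod.factorization p
      = ∑ i ∈ Finset.Ico 1 ((A + B).sum * n + 1), (C.map fun b => b * n / p ^ i).sum := by
    intro C hC
    rw [Nat.factorization_def _ hp,
      padicValNat_multiset_prod p C _ fun a => Nat.factorial_ne_zero _, ← Multiset.sum_map_sum]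
    congr 1
    refine Multiset.map_congr rfl fun a ha => padicValNat_factorial ?_
    have h1 : a ≤ (A + B).sum := Multiset.single_le_sum (by simp) _ (Multiset.mem_of_le hC ha)
    exact Nat.lt_succ_of_le ((Nat.log_le_self p _).trans (Nat.mul_le_mul_right n h1))
  rw [hval B (Multiset.le_add_left _ _), hval A (Multiset.le_add_right _ _)]
  exact Finset.sum_le_sum fun i _ => h n (p ^ i) (pow_pos hp.pos i)

/-- Landau's criterion, necessity. -/
theorem sum_floor_le_of_integral {A B : Multiset ℕ} (hA : ∀ a ∈ A, 0 < a) (hB : ∀ b ∈ B, 0 < b)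
    (hsum : A.sum = B.sum) (hint : ∀ n : ℕ, ∃ m : ℕ, factorialRatio A B n = m) (x : ℝ) :
    (B.map fun b : ℕ => ⌊(b : ℝ) * x⌋).sum ≤ (A.map fun a : ℕ => ⌊(a : ℝ) * x⌋).sum := by
  have hfr : ∀ C : Multiset ℕ, (C.map fun a : ℕ => ⌊(a : ℝ) * x⌋).sum
      = (C.map fun a : ℕ => ⌊(a : ℝ) * Int.fract x⌋).sum + C.sum * ⌊x⌋ := by
    intro C
    induction C using Multiset.induction_on with
    | empty => simp
    | cons a C ih =>
      have : ⌊(a : ℝ) * x⌋ = ⌊(a : ℝ) * Int.fract x⌋ + a * ⌊x⌋ := by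
        rw [← Int.floor_add_intCast]
        congr 1
        conv_lhs => rw [← Int.fract_add_floor x]
        push_cast; ring
      simp only [Multiset.map_cons, Multiset.sum_cons, ih, this]
      push_cast; ring
  rw [hfr A, hfr B, hsum]
  refine add_le_add ?_ le_rfl
  set x₀ := Int.fract x with hx₀
  have hx0 : 0 ≤ x₀ := Int.fract_nonneg x
  have hx1 : x₀ < 1 := Int.fract_lt_one x
  have hev : ∀ᶠ y in nhdsWithin x₀ (Set.Ioi x₀), ∀ a ∈ (A + B).toFinset,
      ⌊(a : ℝ) * y⌋ = ⌊(a : ℝ) * x₀⌋ := by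
    rw [Filter.eventually_all_finset]
    intro a ha
    have ha0 : 0 < a := by
      rcases Multiset.mem_add.1 (Multiset.mem_toFinset.1 ha) with h | h
      exacts [hA a h, hB a h]
    filter_upwards [eventually_floor_affine_eq (by exact_mod_cast ha0 : (0 : ℝ) < a) 0 x₀] with y hy
    simpa using hy.1
  obtain ⟨u, hu, hIoo⟩ := mem_nhdsGT_iff_exists_Ioo_subset.1 hev
  have hδ : 0 < u - x₀ := sub_pos.2 hu
  -- The prime is so large that some `n / p` lies just to the right of `x₀`, where no floor has
  -- changed, and that `p` exceeds all entries.
  obtain ⟨p, hple, hp⟩ := Nat.exists_infinite_primes (max (⌈1 / (u - x₀)⌉₊ + 1) ((A + B).sum + 1))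
  have : Fact p.Prime := ⟨hp⟩
  have hp0 : (0 : ℝ) < p := by exact_mod_cast hp.pos
  have hpu : 1 / (p : ℝ) < u - x₀ := by
    rw [one_div_lt hp0 hδ]
    have h1 : ⌈1 / (u - x₀)⌉₊ + 1 ≤ p := (le_max_left _ _).trans hple
    have h2 : ((⌈1 / (u - x₀)⌉₊ + 1 : ℕ) : ℝ) ≤ p := by exact_mod_cast h1
    push_cast at h2
    linarith [Nat.le_ceil (1 / (u - x₀))]
  have hpsum : (A + B).sum < p := (le_max_right _ _).trans hple
  set n := ⌊x₀ * p⌋₊ + 1 with hn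
  have hxp : 0 ≤ x₀ * p := by positivity
  have hn1 : x₀ < (n : ℝ) / p := by
    rw [lt_div_iff₀ hp0, hn]; push_cast
    exact Nat.lt_floor_add_one _
  have hn2 : (n : ℝ) / p < u := by
    have h1 : (n : ℝ) / p ≤ x₀ + 1 / p := by
      rw [div_le_iff₀ hp0, add_mul, one_div_mul_cancel hp0.ne', hn]; push_cast
      linarith [Nat.floor_le hxp]
    linarith
  have hnp : n ≤ p := by
    have : ⌊x₀ * p⌋₊ < p := by
      rw [Nat.floor_lt hxp]
      nlinarith
    omega
  have hfloor := hIoo ⟨hn1, hn2⟩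
  simp only [Set.mem_ofPred_eq] at hfloor
  have hval : ∀ C : Multiset ℕ, C ≤ A + B →
      ((padicValNat p (C.map fun b => (b * n)!).prod : ℕ) : ℤ)
        = (C.map fun a : ℕ => ⌊(a : ℝ) * x₀⌋).sum := by
    intro C hC
    rw [padicValNat_multiset_prod p C _ fun a => Nat.factorial_ne_zero _, Nat.cast_multiset_sum,
      Multiset.map_map]
    congr 1
    refine Multiset.map_congr rfl fun a ha => ?_
    have hmem : a ∈ A + B := Multiset.mem_of_le hC ha
    have h1 : a ≤ (A + B).sum := Multiset.single_le_sum (by simp) _ hmem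
    -- Only the first term of Legendre's formula survives, so the valuation of `(a * n)!` is `⌊a * n
    -- / p⌋`.
    have hlt : a * n < p ^ 2 := by
      rw [sq]
      calc a * n ≤ a * p := Nat.mul_le_mul_left a hnp
        _ < p * p := Nat.mul_lt_mul_of_pos_right (h1.trans_lt hpsum) hp.pos
    rw [Function.comp_apply, padicValNat_factorial (b := 2) (Nat.log_lt_of_lt_pow' (by norm_num) hlt),
      ← hfloor a (Multiset.mem_toFinset.2 hmem)]
    have h2 : (a : ℝ) * (n / p) = ((a * n : ℕ) : ℝ) / (p : ℕ) := by push_cast; ring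
    rw [h2, Int.floor_div_natCast, Int.floor_natCast]
    simp
  have hdvd := (factorialRatio_eq_natCast_iff A B n).1 (hint n)
  have hne : (A.map fun a => (a * n)!).prod ≠ 0 := by
    rw [Ne, Multiset.prod_eq_zero_iff, Multiset.mem_map]
    rintro ⟨b, -, hb⟩
    exact Nat.factorial_ne_zero _ hb
  have hle := padicValNat_dvd_iff_le (p := p) hne |>.1 (pow_padicValNat_dvd.trans hdvd)
  rw [← hval B (Multiset.le_add_left _ _), ← hval A (Multiset.le_add_right _ _)]
  exact_mod_cast hle

/-- Equal sums cancel the linear part, and the sum is `-1/2 + D` with `D` the difference of floor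
sums. At a generic `y` just right of `x`, oddness reads `D y + D (-y) = 1`; both terms are
nonnegative by Landau's criterion. -/
theorem sawFinsupp_eq_half_of_integral {A B : Multiset ℕ} (h : IsIntegralFactorialRatio A B)
    (hcard : B.card = A.card + 1) (x : ℝ) :
    sawFinsupp (multisetWeight A - multisetWeight B) x = 1 / 2 ∨
      sawFinsupp (multisetWeight A - multisetWeight B) x = -(1 / 2) := by
  set D : ℝ → ℤ := fun x => (A.map fun a : ℕ => ⌊(a : ℝ) * x⌋).sum
    - (B.map fun b : ℕ => ⌊(b : ℝ) * x⌋).sum with hD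
  have hf : ∀ x, sawFinsupp (multisetWeight A - multisetWeight B) x = -(1 / 2) + D x := by
    intro x
    rw [sawFinsupp_sub, sawFinsupp_multisetWeight_eq_floor, sawFinsupp_multisetWeight_eq_floor,
      hcard, h.sum_eq, hD]
    push_cast; ring
  have hD0 : ∀ x, 0 ≤ D x := fun x => sub_nonneg.2
    (sum_floor_le_of_integral h.pos_left h.pos_right h.sum_eq h.integral x)
  have hev : ∀ᶠ y in nhdsWithin x (Set.Ioi x), ∀ a ∈ (A + B).toFinset,
      ⌊(a : ℝ) * y⌋ = ⌊(a : ℝ) * x⌋ ∧ Int.fract ((a : ℝ) * y) ≠ 0 := by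
    rw [Filter.eventually_all_finset]
    intro a ha
    have ha0 : 0 < a := by
      rcases Multiset.mem_add.1 (Multiset.mem_toFinset.1 ha) with h' | h'
      exacts [h.pos_left a h', h.pos_right a h']
    simpa using eventually_floor_affine_eq (by exact_mod_cast ha0 : (0 : ℝ) < a) 0 x
  obtain ⟨y, hy⟩ := hev.exists
  have hyA : ∀ a ∈ A, ⌊(a : ℝ) * y⌋ = ⌊(a : ℝ) * x⌋ ∧ Int.fract ((a : ℝ) * y) ≠ 0 := fun a ha =>
    hy a (Multiset.mem_toFinset.2 (Multiset.mem_add.2 (Or.inl ha)))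
  have hyB : ∀ a ∈ B, ⌊(a : ℝ) * y⌋ = ⌊(a : ℝ) * x⌋ ∧ Int.fract ((a : ℝ) * y) ≠ 0 := fun a ha =>
    hy a (Multiset.mem_toFinset.2 (Multiset.mem_add.2 (Or.inr ha)))
  have hDy : D y = D x := by
    simp only [hD]
    rw [Multiset.map_congr rfl fun a ha => (hyA a ha).1,
      Multiset.map_congr rfl fun a ha => (hyB a ha).1]
  have hneg : ∀ C : Multiset ℕ, (∀ a ∈ C, Int.fract ((a : ℝ) * y) ≠ 0) →
      sawFinsupp (multisetWeight C) (-y) = -sawFinsupp (multisetWeight C) y := by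
    intro C hC
    rw [sawFinsupp_multisetWeight, sawFinsupp_multisetWeight, ← Multiset.sum_map_neg',
      Multiset.map_map]
    refine congrArg _ (Multiset.map_congr rfl fun a ha => ?_)
    rw [mul_neg, saw_neg_of_fract_ne_zero (hC a ha), Function.comp_apply]
  have hodd : -(1 / 2) + (D (-y) : ℝ) = -(-(1 / 2) + D y) := by
    rw [← hf, ← hf, sawFinsupp_sub, sawFinsupp_sub, hneg A fun a ha => (hyA a ha).2,
      hneg B fun a ha => (hyB a ha).2]
    ring
  have hD1 : D (-y) + D y = 1 := by
    have : ((D (-y) + D y : ℤ) : ℝ) = 1 := by push_cast; linarith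
    exact_mod_cast this
  have h1 := hD0 (-y)
  have h2 := hD0 x
  rw [hf]
  obtain h3 | h3 : D x = 0 ∨ D x = 1 := by omega
  · right; rw [h3]; norm_num
  · left; rw [h3]; norm_num

/-! ### Pairs as weighted dilations, and finiteness for fixed weights -/

/-- The pair of multisets in which `m i` occurs `c i` times on the left if `c i` is positive, and
`-c i` times on the right if it is negative. -/
def weightedPair {s : ℕ} (c : Fin s → ℤ) (m : Fin s → ℕ) : Multiset ℕ × Multiset ℕ :=
  (∑ i, (c i).toNat • {m i}, ∑ i, (-c i).toNat • {m i})

theorem multisetWeight_sum_nsmul {s : ℕ} (k : Fin s → ℕ) (m : Fin s → ℕ) :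
    multisetWeight (∑ i, k i • {m i}) = ∑ i, Finsupp.single (m i) (k i : ℤ) := by
  ext l
  rw [multisetWeight_apply, Multiset.count_sum', Finsupp.finsetSum_apply, Nat.cast_sum]
  refine Finset.sum_congr rfl fun i _ => ?_
  rw [Multiset.count_nsmul, Multiset.count_singleton, Finsupp.single_apply]
  simp only [eq_comm (a := l)]
  split_ifs <;> simp

theorem multisetWeight_weightedPair {s : ℕ} (c : Fin s → ℤ) (m : Fin s → ℕ) :
    multisetWeight (weightedPair c m).1 - multisetWeight (weightedPair c m).2
      = weightFinsupp Finset.univ c m := by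
  rw [weightedPair, multisetWeight_sum_nsmul, multisetWeight_sum_nsmul, ← Finset.sum_sub_distrib,
    weightFinsupp]
  refine Finset.sum_congr rfl fun i _ => ?_
  rw [← Finsupp.single_sub]
  congr 1
  omega

theorem weightedPair_disjoint {s : ℕ} (c : Fin s → ℤ) {m : Fin s → ℕ}
    (hm : Function.Injective m) : ∀ a ∈ (weightedPair c m).1, a ∉ (weightedPair c m).2 := by
  intro a h1 h2
  simp only [weightedPair, Multiset.mem_sum, Finset.mem_univ, true_and] at h1 h2
  obtain ⟨i, hi⟩ := h1
  obtain ⟨j, hj⟩ := h2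
  have hi' := Multiset.mem_of_mem_nsmul hi
  have hj' := Multiset.mem_of_mem_nsmul hj
  rw [Multiset.mem_singleton] at hi' hj'
  obtain rfl := hm (hi'.symm.trans hj')
  have hi0 : (c i).toNat ≠ 0 := fun h => by simp [h] at hi
  have hj0 : (-c i).toNat ≠ 0 := fun h => by simp [h] at hj
  omega

theorem exists_weightedPair_eq {A B : Multiset ℕ} (h : ∀ a ∈ A, a ∉ B) (hA : ∀ a ∈ A, 0 < a)
    (hB : ∀ b ∈ B, 0 < b) : ∃ (s : ℕ) (c : Fin s → ℤ) (m : Fin s → ℕ), Function.Injective m ∧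
      (∀ i, 0 < m i) ∧ (∀ i, c i ≠ 0) ∧ weightedPair c m = (A, B) := by
  set w := multisetWeight A - multisetWeight B with hw
  let e := w.support.equivFin.symm
  set m : Fin w.support.card → ℕ := fun i => (e i : ℕ) with hm
  have hinj : Function.Injective m := Subtype.val_injective.comp e.injective
  have hmem : ∀ i, m i ∈ w.support := fun i => (e i).2
  have hwF : weightFinsupp Finset.univ (fun i => w (m i)) m = w := by
    rw [weightFinsupp]
    conv_rhs => rw [← Finsupp.sum_single w, Finsupp.sum, ← Finset.sum_coe_sort]
    exact e.sum_comp fun k => Finsupp.single (k : ℕ) (w k)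
  refine ⟨_, fun i => w (m i), m, hinj, fun i => ?_, fun i => Finsupp.mem_support_iff.1 (hmem i), ?_⟩
  · have h1 := Finsupp.mem_support_iff.1 (hmem i)
    rw [hw, Finsupp.sub_apply, multisetWeight_apply, multisetWeight_apply] at h1
    by_cases hmA : m i ∈ A
    · exact hA _ hmA
    · by_cases hmB : m i ∈ B
      · exact hB _ hmB
      · rw [Multiset.count_eq_zero.2 hmA, Multiset.count_eq_zero.2 hmB] at h1
        simp at h1
  · obtain ⟨h1, h2⟩ := eq_of_multisetWeight_sub_eq (weightedPair_disjoint _ hinj) h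
      ((multisetWeight_weightedPair _ _).trans hwF)
    exact Prod.ext h1 h2

/-- The dilations whose pair with weights `c` is an exceptional integral factorial ratio. -/
def exceptionalDilations {s : ℕ} (c : Fin s → ℤ) : Set (Fin s → ℕ) :=
  {m | Function.Injective m ∧ (∀ i, 0 < m i) ∧ weightedPair c m ∈
    primitiveIntegralFactorialRatios 1 \ (firstFamily ∪ secondFamily ∪ thirdFamily)}

section Exceptional

variable {s : ℕ} {c : Fin s → ℤ} {m m' : Fin s → ℕ}

theorem sawSum_of_mem_exceptional (h : m ∈ exceptionalDilations c) (x : ℝ) :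
    sawSum Finset.univ c m x = 1 / 2 ∨ sawSum Finset.univ c m x = -(1 / 2) := by
  obtain ⟨-, -, ⟨h1, -, h3⟩, -⟩ := h
  have := sawFinsupp_eq_half_of_integral h1 h3 x
  rwa [multisetWeight_weightedPair, sawFinsupp_weightFinsupp] at this

theorem sum_mul_of_mem_exceptional (h : m ∈ exceptionalDilations c) :
    ∑ i, c i * m i = 0 := by
  obtain ⟨-, -, ⟨h1, -, h3⟩, -⟩ := h
  let moment : (ℕ →₀ ℤ) →+ ℤ := Finsupp.liftAddHom fun k => AddMonoidHom.mulRight (k : ℤ)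
  have hmA : ∀ A : Multiset ℕ, moment (multisetWeight A) = A.sum := fun A => by
    rw [map_multisetWeight]; simp [moment]
  have e := congrArg moment (multisetWeight_weightedPair c m)
  rw [map_sub, hmA, hmA, h1.sum_eq, sub_self, weightFinsupp, map_sum] at e
  rw [e]
  simp [moment]

theorem gcd_of_mem_exceptional (h : m ∈ exceptionalDilations c) : Finset.univ.gcd m = 1 := by
  obtain ⟨hinj, -, ⟨-, h2, -⟩, -⟩ := h
  refine eq_one_of_dvd_support (weightedPair_disjoint c hinj) h2 fun k hk => ?_
  rw [multisetWeight_weightedPair, weightFinsupp, Finsupp.finsetSum_apply]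
  refine Finset.sum_eq_zero fun i hi => Finsupp.single_eq_of_ne ?_
  rintro rfl
  exact hk (Finset.gcd_dvd hi)

/-- Primitivity makes the gcd of the dilations `1`, which fixes the scale. -/
theorem eq_of_proportional_exceptional (h : m ∈ exceptionalDilations c)
    (h' : m' ∈ exceptionalDilations c) (hp : ∀ i j, m' i * m j = m' j * m i) : m = m' := by
  funext i
  have h1 : m i * Finset.univ.gcd m' = m' i * Finset.univ.gcd m := by
    have e1 := Finset.gcd_mul_left (s := Finset.univ) (f := m') (a := m i)
    have e2 := Finset.gcd_mul_left (s := Finset.univ) (f := m) (a := m' i)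
    rw [normalize_eq] at e1 e2
    rw [← e1, ← e2]
    exact Finset.gcd_congr rfl fun j _ => by rw [hp i j, mul_comm]
  rwa [gcd_of_mem_exceptional h, gcd_of_mem_exceptional h', mul_one, mul_one] at h1

/-- Since `∑ c i * m i = 0`, a small move of `x` to the right changes neither the floors nor the
sum, so generic values determine all values. Two different slopes would then put the pair into one
of the families. -/
theorem slopes_eq_of_mem_exceptional (hc : ∀ i, c i ≠ 0) (h : m ∈ exceptionalDilations c)
    {b : Fin s → ℤ}
    (hgen : ∀ x y : ℝ, (∀ i, Int.fract (m i * x + b i * y) ≠ 0) →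
      ∑ i, (c i : ℝ) * saw (m i * x + b i * y) = 1 / 2 ∨
      ∑ i, (c i : ℝ) * saw (m i * x + b i * y) = -(1 / 2)) (i j : Fin s) :
    (b i : ℚ) / m i = (b j : ℚ) / m j := by
  have hm := h.2.1
  have hall : ∀ x y : ℝ, ∑ i, (c i : ℝ) * saw (m i * x + b i * y) = 1 / 2 ∨
      ∑ i, (c i : ℝ) * saw (m i * x + b i * y) = -(1 / 2) := by
    intro x y
    have hev : ∀ᶠ z in nhdsWithin x (Set.Ioi x), ∀ i,
        ⌊m i * z + b i * y⌋ = ⌊m i * x + b i * y⌋ ∧ Int.fract (m i * z + b i * y) ≠ 0 := by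
      rw [Filter.eventually_all]
      exact fun i => eventually_floor_affine_eq (by exact_mod_cast hm i) _ x
    obtain ⟨z, hz⟩ := hev.exists
    have h0 : ∑ i, (c i : ℝ) * m i = 0 := by exact_mod_cast sum_mul_of_mem_exceptional h
    have heq : ∑ i, (c i : ℝ) * saw (m i * z + b i * y)
        = ∑ i, (c i : ℝ) * saw (m i * x + b i * y) := by
      rw [← sub_eq_zero, ← Finset.sum_sub_distrib, ← mul_zero (x - z), ← h0, Finset.mul_sum]
      refine Finset.sum_congr rfl fun i _ => ?_
      rw [saw_eq, saw_eq, (hz i).1]; ring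
    rw [← heq]
    exact hgen z y fun i => (hz i).2
  by_contra hij
  obtain ⟨N, ε, w, hw, hN⟩ := exists_three_parts hm h.1 hc hall ⟨i, j, hij⟩
  obtain ⟨hinj, -, ⟨h1, h2, h3⟩, h4⟩ := h
  exact h4 (mem_families_of_parts h1.nondegenerate h2 h1.sum_eq h3 (hN 0).1 (hN 1).1 (hN 2).1
    (hN 0).2.1 (hN 1).2.1 (hN 2).2.1 (hN 0).2.2 (hN 1).2.2 (hN 2).2.2
    ((multisetWeight_weightedPair c m).trans hw))

/-- Induction on the rank of `L`. Either the function on the real span of `L` is generically `±1/2`,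
and `L` contains at most one exceptional vector, or all exceptional vectors of `L` lie in finitely
many sublattices of smaller rank. -/
theorem finite_exceptional_of_submodule (hc : ∀ i, c i ≠ 0) :
    ∀ (d : ℕ) (L : Submodule ℤ (Fin s → ℤ)), Module.finrank ℤ L = d →
      {m ∈ exceptionalDilations c | (fun i => (m i : ℤ)) ∈ L}.Finite := by
  intro d
  induction d using Nat.strong_induction_on with
  | _ d ih =>
  intro L hd
  let e := Module.finBasis ℤ L
  have hrepr : ∀ v : L, ∀ i, (v : Fin s → ℤ) i = ∑ j, e.repr v j * (e j : Fin s → ℤ) i := by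
    intro v i
    conv_lhs => rw [← e.sum_repr v]
    simp only [AddSubmonoidClass.coe_finsetSum, Finset.sum_apply, Submodule.coe_smul, Pi.smul_apply,
      smul_eq_mul]
  by_cases hgood : ∀ t : Fin (Module.finrank ℤ L) → ℝ,
      (∀ i, Int.fract (∑ j, ((e j : Fin s → ℤ) i : ℝ) * t j) ≠ 0) →
      ∑ i, (c i : ℝ) * saw (∑ j, ((e j : Fin s → ℤ) i : ℝ) * t j) = 1 / 2 ∨
      ∑ i, (c i : ℝ) * saw (∑ j, ((e j : Fin s → ℤ) i : ℝ) * t j) = -(1 / 2)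
  · apply Set.Subsingleton.finite
    rintro m ⟨hm, hmL⟩ m' ⟨hm', hmL'⟩
    apply eq_of_proportional_exceptional hm hm'
    have hlin : ∀ x y : ℝ, ∀ i, ∑ j, ((e j : Fin s → ℤ) i : ℝ)
        * (e.repr ⟨_, hmL⟩ j * x + e.repr ⟨_, hmL'⟩ j * y) = m i * x + (m' i : ℤ) * y := by
      intro x y i
      have h1 : (m i : ℝ) = ∑ j, (e.repr ⟨_, hmL⟩ j : ℝ) * ((e j : Fin s → ℤ) i : ℝ) := by
        exact_mod_cast hrepr ⟨_, hmL⟩ i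
      have h2 : (m' i : ℝ) = ∑ j, (e.repr ⟨_, hmL'⟩ j : ℝ) * ((e j : Fin s → ℤ) i : ℝ) := by
        exact_mod_cast hrepr ⟨_, hmL'⟩ i
      rw [Int.cast_natCast, h1, h2, Finset.sum_mul, Finset.sum_mul, ← Finset.sum_add_distrib]
      refine Finset.sum_congr rfl fun j _ => ?_
      ring
    have hsl := slopes_eq_of_mem_exceptional hc hm (b := fun i => (m' i : ℤ)) fun x y hxy => by
      have := hgood (fun j => e.repr ⟨_, hmL⟩ j * x + e.repr ⟨_, hmL'⟩ j * y)
      simp only [hlin] at this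
      exact this hxy
    intro i j
    have hi : (m i : ℚ) ≠ 0 := by exact_mod_cast (hm.2.1 i).ne'
    have hj : (m j : ℚ) ≠ 0 := by exact_mod_cast (hm.2.1 j).ne'
    have := hsl i j
    rw [div_eq_div_iff hi hj] at this
    exact_mod_cast this
  · push Not at hgood
    obtain ⟨t₀, ht₀, hne1, hne2⟩ := hgood
    set F : (Fin (Module.finrank ℤ L) → ℝ) → ℝ := fun t =>
      ∑ i, (c i : ℝ) * saw (∑ j, ((e j : Fin s → ℤ) i : ℝ) * t j) with hF
    have hcont : ContinuousAt F t₀ := by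
      refine tendsto_finsetSum _ fun i _ => Filter.Tendsto.const_mul _ ?_
      have h1 : ContinuousAt saw (∑ j, ((e j : Fin s → ℤ) i : ℝ) * t₀ j) := by
        refine continuousAt_const.sub (continuousAt_fract ?_)
        intro h
        exact ht₀ i (by rw [← Int.self_sub_floor]; linarith)
      exact ContinuousAt.comp' (f := fun t : Fin (Module.finrank ℤ L) → ℝ =>
        ∑ j, ((e j : Fin s → ℤ) i : ℝ) * t j) h1
        (continuous_finsetSum _ fun j _ => by fun_prop).continuousAt
    have hV : ∀ᶠ t in nhds t₀, F t ≠ 1 / 2 ∧ F t ≠ -(1 / 2) :=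
      (hcont.eventually_ne hne1).and (hcont.eventually_ne hne2)
    obtain ⟨V, hVsub, hVo, hVt⟩ := mem_nhds_iff.1 hV
    obtain ⟨S, hS0, hS⟩ := exists_characters_of_isOpen hVo ⟨t₀, hVt⟩
    -- The sublattice of `L` on which the character with coordinates `n` in the basis `e` vanishes.
    let ker : (Fin (Module.finrank ℤ L) → ℤ) → Submodule ℤ (Fin s → ℤ) := fun n =>
      (LinearMap.ker (e.constr ℤ n)).map L.subtype
    have hker : ∀ n ∈ S, Module.finrank ℤ (ker n) < d := by
      intro n hn
      have h1 : Module.finrank ℤ (ker n) = Module.finrank ℤ (LinearMap.ker (e.constr ℤ n)) :=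
        Submodule.finrank_map_subtype_eq _ _
      have h2 := (LinearMap.ker (e.constr ℤ n)).finrank_quotient_add_finrank
      rw [(e.constr ℤ n).quotKerEquivRange.finrank_eq] at h2
      have h3 : 0 < Module.finrank ℤ (LinearMap.range (e.constr ℤ n)) := by
        obtain ⟨j, hj⟩ := Function.ne_iff.1 (hS0 n hn)
        have hmem : n j ∈ LinearMap.range (e.constr ℤ n) := ⟨e j, e.constr_basis ℤ n j⟩
        have : Nontrivial (LinearMap.range (e.constr ℤ n)) :=
          ⟨⟨n j, hmem⟩, 0, fun h => hj (congrArg Subtype.val h)⟩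
        exact Module.finrank_pos
      omega
    refine Set.Finite.subset (S.finite_toSet.biUnion fun n hn => ih _ (hker n hn) (ker n) rfl) ?_
    rintro m ⟨hm, hmL⟩
    -- Otherwise the line in direction `m` meets `V` modulo the lattice, and the sum for `m` takes a
    -- value other than `±1/2`.
    have hex : ∃ n ∈ S, ∑ j, n j * e.repr ⟨_, hmL⟩ j = 0 := by
      by_contra! hno
      obtain ⟨x, v, hv, hk⟩ := hS (fun j => e.repr ⟨_, hmL⟩ j) hno
      choose k hk using hk
      have hFv : sawSum Finset.univ c m x = F v := by
        refine Finset.sum_congr rfl fun i _ => ?_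
        have h1 : (m i : ℝ) = ∑ j, (e.repr ⟨_, hmL⟩ j : ℝ) * ((e j : Fin s → ℤ) i : ℝ) := by
          exact_mod_cast hrepr ⟨_, hmL⟩ i
        have h2 : (m i : ℝ) * x = ∑ j, ((e j : Fin s → ℤ) i : ℝ) * v j
            + ((∑ j, (e j : Fin s → ℤ) i * k j : ℤ) : ℝ) := by
          rw [h1, Finset.sum_mul]
          push_cast
          rw [← Finset.sum_add_distrib]
          refine Finset.sum_congr rfl fun j _ => ?_
          rw [mul_right_comm, hk j]; ring
        rw [h2, saw_add_intCast]
      have h3 := hVsub hv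
      have h4 := sawSum_of_mem_exceptional hm x
      rw [hFv] at h4
      exact h4.elim h3.1 h3.2
    obtain ⟨n, hn, hn0⟩ := hex
    refine Set.mem_biUnion hn ⟨hm, ⟨⟨_, hmL⟩, ?_, rfl⟩⟩
    rw [SetLike.mem_coe, LinearMap.mem_ker, Module.Basis.constr_apply_fintype]
    simpa [mul_comm] using hn0

theorem finite_exceptionalDilations (hc : ∀ i, c i ≠ 0) : (exceptionalDilations c).Finite := by
  simpa using finite_exceptional_of_submodule hc _ ⊤ rfl

end Exceptional

/-! ### Finiteness of the exceptional set -/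

/-- The length bound confines `s` and `c` to a finite set, and each `c` admits finitely many
exceptional dilations. -/
theorem finite_exceptional : (primitiveIntegralFactorialRatios 1 \
    (firstFamily ∪ secondFamily ∪ thirdFamily)).Finite := by
  obtain ⟨M, hM⟩ := exists_length_bound
  have hfin : (⋃ s ∈ Set.Iic M, ⋃ c ∈ {c : Fin s → ℤ | c ∈ Set.Icc (fun _ => -(M : ℤ)) (fun _ => (M : ℤ))
      ∧ ∀ i, c i ≠ 0}, weightedPair c '' exceptionalDilations c).Finite :=
    (Set.finite_Iic M).biUnion fun s _ =>
      ((Set.finite_Icc _ _).subset fun c hc => hc.1).biUnion fun c hc =>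
        (finite_exceptionalDilations hc.2).image _
  refine hfin.subset ?_
  rintro ⟨A, B⟩ hAB
  obtain ⟨s, c, m, hinj, hm, hc, he⟩ := exists_weightedPair_eq hAB.1.1.nondegenerate
    hAB.1.1.pos_left hAB.1.1.pos_right
  have hmem : m ∈ exceptionalDilations c := ⟨hinj, hm, he ▸ hAB⟩
  obtain ⟨hs, hcM⟩ := hM s c m hinj hm hc
    (gcdForm_eq_three (fun i _ => hm i) (sawSum_of_mem_exceptional hmem))
  refine Set.mem_biUnion hs (Set.mem_biUnion (x := c) ⟨⟨?_, ?_⟩, hc⟩ ⟨m, hmem, he⟩)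
  · exact fun i => (abs_le.1 (hcM i)).1
  · exact fun i => (abs_le.1 (hcM i)).2

/-! ### The three families consist of integral ratios and are infinite -/

/-- Landau's inequality for the second family. For remainders `u`, `v` it says that `u + v ≥ q`
forces `2 * u ≥ q` or `2 * v ≥ q`. -/
theorem add_div_add_add_div_le (X Y q : ℕ) (hq : 0 < q) :
    X / q + (Y / q + (X + Y) / q) ≤ 2 * X / q + 2 * Y / q := by
  obtain ⟨x, u, hu, rfl⟩ : ∃ x u, u < q ∧ X = u + q * x :=
    ⟨X / q, X % q, Nat.mod_lt _ hq, (Nat.mod_add_div X q).symm⟩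
  obtain ⟨y, v, hv, rfl⟩ : ∃ y v, v < q ∧ Y = v + q * y :=
    ⟨Y / q, Y % q, Nat.mod_lt _ hq, (Nat.mod_add_div Y q).symm⟩
  rw [show u + q * x + (v + q * y) = (u + v) + q * (x + y) by ring,
    show 2 * (u + q * x) = 2 * u + q * (2 * x) by ring,
    show 2 * (v + q * y) = 2 * v + q * (2 * y) by ring]
  simp only [Nat.add_mul_div_left _ _ hq, Nat.div_eq_of_lt hu, Nat.div_eq_of_lt hv]
  have h1 : (u + v) / q < 2 := Nat.div_lt_of_lt_mul (by omega)
  have h2 : q ≤ 2 * u → 0 < 2 * u / q := fun h => Nat.div_pos h hq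
  have h3 : q ≤ 2 * v → 0 < 2 * v / q := fun h => Nat.div_pos h hq
  have h4 : u + v < q → (u + v) / q = 0 := Nat.div_eq_of_lt
  generalize 2 * u / q = U at *
  generalize 2 * v / q = V at *
  generalize (u + v) / q = W at *
  omega

/-- Landau's inequality for the third family, with `Y`, `Z` in the roles of `b n` and `(a - b) n`.
If the remainders satisfy `v + w ≥ q`, then `2 * (v + w) / q ≥ 2`; otherwise monotonicity suffices.
-/
theorem add_div_add_two_mul_div_le (Y Z q : ℕ) (hq : 0 < q) :
    (Y + Z) / q + (2 * Y / q + Z / q) ≤ 2 * (Y + Z) / q + Y / q := by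
  obtain ⟨y, v, hv, rfl⟩ : ∃ y v, v < q ∧ Y = v + q * y :=
    ⟨Y / q, Y % q, Nat.mod_lt _ hq, (Nat.mod_add_div Y q).symm⟩
  obtain ⟨z, w, hw, rfl⟩ : ∃ z w, w < q ∧ Z = w + q * z :=
    ⟨Z / q, Z % q, Nat.mod_lt _ hq, (Nat.mod_add_div Z q).symm⟩
  rw [show 2 * (v + q * y + (w + q * z)) = 2 * (v + w) + q * (2 * (y + z)) by ring,
    show v + q * y + (w + q * z) = (v + w) + q * (y + z) by ring,
    show 2 * (v + q * y) = 2 * v + q * (2 * y) by ring]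
  simp only [Nat.add_mul_div_left _ _ hq, Nat.div_eq_of_lt hv, Nat.div_eq_of_lt hw]
  have h1 : (v + w) / q < 2 := Nat.div_lt_of_lt_mul (by omega)
  have h2 : 2 * v / q < 2 := Nat.div_lt_of_lt_mul (by omega)
  have h3 : 2 * v / q ≤ 2 * (v + w) / q := Nat.div_le_div_right (by omega)
  by_cases h : v + w < q
  · rw [Nat.div_eq_of_lt h]; omega
  · have : 2 ≤ 2 * (v + w) / q := (Nat.le_div_iff_mul_le hq).2 (by omega)
    omega

theorem gcd_eq_one_of_mem_coprime {C : Multiset ℕ} {a b : ℕ} (ha : a ∈ C) (hb : b ∈ C)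
    (hab : Nat.Coprime a b) : C.gcd = 1 :=
  Nat.dvd_one.1 (hab ▸ Nat.dvd_gcd (Multiset.gcd_dvd ha) (Multiset.gcd_dvd hb))

theorem firstFamily_subset : firstFamily ⊆ primitiveIntegralFactorialRatios 1 := by
  rintro _ ⟨a, b, ha, hb, hab, rfl⟩
  refine ⟨⟨?_, ?_, ?_, ?_, integral_of_sum_div_le fun n q _ => ?_⟩,
    gcd_eq_one_of_mem_coprime (a := a) (b := b) (by simp) (by simp) hab, by simp⟩
  · simp; omega
  · simp; omega
  · simp
  · simp; omega
  · simpa [add_mul] using Nat.div_add_div_le_add_div (x := a * n) (y := b * n) (z := q)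

theorem secondFamily_subset : secondFamily ⊆ primitiveIntegralFactorialRatios 1 := by
  rintro _ ⟨a, b, ha, hb, hab, h11, h12, h21, rfl⟩
  have h1 : b = 2 * a → a = 1 := fun h => by
    rwa [h, Nat.Coprime, Nat.gcd_eq_left (Dvd.intro_left 2 rfl)] at hab
  have h2 : a = 2 * b → b = 1 := fun h => by
    rwa [h, Nat.Coprime, Nat.gcd_eq_right (Dvd.intro_left 2 rfl)] at hab
  have h3 : a = b → a = 1 := fun h => by
    rwa [← h, Nat.Coprime, Nat.gcd_self] at hab
  simp only [ne_eq, Prod.mk.injEq] at h11 h12 h21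
  refine ⟨⟨?_, ?_, ?_, ?_, integral_of_sum_div_le fun n q hq => ?_⟩,
    gcd_eq_one_of_mem_coprime (a := a) (b := b) (by simp) (by simp) hab, by simp⟩
  · simp; omega
  · simp; omega
  · simp; omega
  · simp; omega
  · simpa [add_mul, mul_assoc] using add_div_add_add_div_le (a * n) (b * n) q hq

theorem thirdFamily_subset : thirdFamily ⊆ primitiveIntegralFactorialRatios 1 := by
  rintro _ ⟨a, b, hb, hba, hab, h21, rfl⟩
  have h2 : a = 2 * b → b = 1 := fun h => by
    rwa [h, Nat.Coprime, Nat.gcd_eq_right (Dvd.intro_left 2 rfl)] at hab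
  simp only [ne_eq, Prod.mk.injEq] at h21
  refine ⟨⟨?_, ?_, ?_, ?_, integral_of_sum_div_le fun n q hq => ?_⟩,
    gcd_eq_one_of_mem_coprime (a := a) (b := b) (by simp) (by simp) hab, by simp⟩
  · simp; omega
  · simp; omega
  · simp; omega
  · simp; omega
  · have h := add_div_add_two_mul_div_le (b * n) ((a - b) * n) q hq
    rw [← add_mul, Nat.add_sub_cancel' hba.le] at h
    simpa [mul_assoc] using h

theorem firstFamily_infinite : firstFamily.Infinite := by
  refine Set.infinite_of_injective_forall_mem (f := fun k : ℕ =>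
    (({k + 1 + 1}, {k + 1, 1}) : Multiset ℕ × Multiset ℕ)) (fun k l h => ?_)
    fun k => ⟨k + 1, 1, by omega, one_pos, Nat.coprime_one_right _, rfl⟩
  have := congrArg Multiset.sum (Prod.mk.inj h).1
  simpa using this

theorem secondFamily_infinite : secondFamily.Infinite := by
  refine Set.infinite_of_injective_forall_mem (f := fun k : ℕ =>
    (({2 * (k + 3), 2 * 1}, {k + 3, 1, k + 3 + 1}) : Multiset ℕ × Multiset ℕ)) (fun k l h => ?_)
    fun k => ⟨k + 3, 1, by omega, one_pos, Nat.coprime_one_right _, by simp, by simp, by simp, rfl⟩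
  have := congrArg Multiset.sum (Prod.mk.inj h).1
  simpa using this

theorem thirdFamily_infinite : thirdFamily.Infinite := by
  refine Set.infinite_of_injective_forall_mem (f := fun k : ℕ =>
    (({2 * (k + 3), 1}, {k + 3, 2 * 1, k + 3 - 1}) : Multiset ℕ × Multiset ℕ)) (fun k l h => ?_)
    fun k => ⟨k + 3, 1, one_pos, by omega, Nat.coprime_one_right _, by simp, rfl⟩
  have := congrArg Multiset.sum (Prod.mk.inj h).1
  simpa using this

theorem theorem5p1 :
    (firstFamily.Infinite ∧ firstFamily ⊆ primitiveIntegralFactorialRatios 1) ∧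
    (secondFamily.Infinite ∧ secondFamily ⊆ primitiveIntegralFactorialRatios 1) ∧
    (thirdFamily.Infinite ∧ thirdFamily ⊆ primitiveIntegralFactorialRatios 1) ∧
    (primitiveIntegralFactorialRatios 1 \
      (firstFamily ∪ secondFamily ∪ thirdFamily)).Finite :=
  ⟨⟨firstFamily_infinite, firstFamily_subset⟩, ⟨secondFamily_infinite, secondFamily_subset⟩,
    ⟨thirdFamily_infinite, thirdFamily_subset⟩, finite_exceptional⟩
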